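/- Let $H$ be a complex Hilbert space, let $M_0,M_1$ be bounded linear operators on $H$, and put $\mathcal M(z)=zM_0+M_1$ for $z\in\mathbb C$. Assume that $\mathcal M$ is regular (of index $0$), i.e. there is $\nu\in\mathbb R$ such that (a) $\mathcal M(z)$ is boundedly invertible for all $z$ with $\operatorname{Re}z>\nu$ and (b) $z\mapsto\mathcal M(z)^{-1}$ is bounded on $\{\operatorname{Re}z>\nu\}$; let $s_0(\mathcal M)\in[-\infty,\infty)$ be the infimum of all such $\nu$. For $\rho\in\mathbb R$ let $L_{2,\rho}(\mathbb R;H)$ be the space of (classes of) measurable $f:\mathbb R\to H$ with $\int_{\mathbb R}|f(t)|_H^2e^{-2\rho t}\,dt<\infty$, let $H^1_\rho(\mathbb R;H)\subseteq L_{2,\rho}(\mathbb R;H)$ be the domain of the closure in $L_{2,\rho}(\mathbb R;H)$ of $\varphi\mapsto\varphi'$, $\varphi\in C_c^\infty(\mathbb R;H)$, and let $\mathcal L_\rho:L_{2,\rho}(\mathbb R;H)\to L_2(\mathbb R;H)$ be the unitary extension of $(\mathcal L_\rho\varphi)(t)=\frac1{\sqrt{2\pi}}\int_{\mathbb R}e^{-(it+\rho)s}\varphi(s)\,ds$,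 $\varphi\in C_c^\infty(\mathbb R;H)$. Supports of locally integrable functions are understood modulo null sets. Let $u_0\in H$ and $u\in L_{1,\mathrm{loc}}(\mathbb R;H)$. Then the following are equivalent: (i) $\operatorname{spt}u\subseteq[0,\infty)$, $(M_0u)'+M_1u=0$ on $(0,\infty)$ in the sense of distributions, i.e. $-\int_0^\infty\langle M_0u(t),\varphi'(t)\rangle_H\,dt+\int_0^\infty\langle M_1u(t),\varphi(t)\rangle_H\,dt=0$ for all $\varphi\in C_c^\infty((0,\infty);H)$, and $\lim_{t\to0+}\frac1t\int_0^t|M_0(u(s)-u_0)|_H\,ds=0$; (ii) $\operatorname{spt}u\subseteq[0,\infty)$ and $M_0u(t)+\int_0^tM_1u(s)\,ds=M_0u_0$ for a.e. $t>0$; (ii') $u$ is a mild solution with initial value $u_0$, i.e. (ii) holds and moreover $(M_0u)(0+)=M_0u_0$ (limit modulo null sets); (iii) for every $\rho>\max\{s_0(\mathcal M),0\}$ one has $u\in L_{2,\rho}(\mathbb R;H)$ and $(\mathcal L_\rho u)(t)=\frac1{\sqrt{2\pi}}\big((it+\rho)M_0+M_1\big)^{-1}M_0u_0$ for a.e. $t\in\mathbb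 R$; (iii') the condition in (iii) holds for at least one $\rho>\max\{s_0(\mathcal M),0\}$. If these conditions hold, then $M_0(u-\chi_{\mathbb R_{\ge0}}u_0)\in H^1_\rho(\mathbb R;H)$ for every $\rho>\max\{s_0(\mathcal M),0\}$. Moreover, for every $u_0\in H$ there is a mild solution $u\in L_{1,\mathrm{loc}}(\mathbb R;H)$ with initial value $u_0$, and it is unique up to equality almost everywhere. -/

import Mathlib

open MeasureTheory Filter Topology
open scoped ENNReal ContDiff

noncomputable section

namespace DAE

/-! ### The weighted space `L_{2,ρ}(ℝ; H)` -/

/-- The measure `exp (-2ρt) dt` on `ℝ`. -/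
def expMeasure (ρ : ℝ) : Measure ℝ :=
  volume.withDensity fun t => ENNReal.ofReal (Real.exp (-2 * ρ * t))

/-- The Hilbert space `L_{2,ρ}(ℝ; H)`. -/
abbrev L2 (H : Type*) [NormedAddCommGroup H] (ρ : ℝ) : Type _ := Lp H 2 (expMeasure ρ)

lemma volume_ac_expMeasure (ρ : ℝ) : (volume : Measure ℝ) ≪ expMeasure ρ :=
  withDensity_absolutelyContinuous' (by fun_prop)
    (ae_of_all _ fun t => by simp [Real.exp_pos])

lemma expMeasure_ac_volume (ρ : ℝ) : expMeasure ρ ≪ (volume : Measure ℝ) :=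
  withDensity_absolutelyContinuous _ _

lemma ofReal_exp_eq (ρ t : ℝ) :
    ENNReal.ofReal (Real.exp (-2 * ρ * t)) = ‖Real.exp (-ρ * t)‖ₑ ^ (2 : ℝ) := by
  rw [Real.enorm_eq_ofReal (Real.exp_pos _).le, ENNReal.ofReal_rpow_of_pos (Real.exp_pos _),
    ← Real.exp_mul]
  ring_nf

lemma eLpNorm_expMeasure {H : Type*} [NormedAddCommGroup H] [InnerProductSpace ℂ H]
    (ρ : ℝ) (f : ℝ → H) :
    eLpNorm (fun t => (Real.exp (-ρ * t) : ℂ) • f t) 2 volume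
      = eLpNorm f 2 (expMeasure ρ) := by
  rw [eLpNorm_eq_lintegral_rpow_enorm_toReal (by simp) (by simp),
    eLpNorm_eq_lintegral_rpow_enorm_toReal (by simp) (by simp), expMeasure,
    lintegral_withDensity_eq_lintegral_mul_non_measurable _ (by fun_prop)
      (ae_of_all _ fun t => by simp)]
  congr 2
  funext t
  simp only [Pi.mul_apply, ofReal_exp_eq, enorm_smul, ENNReal.toReal_ofNat]
  rw [ENNReal.mul_rpow_of_nonneg _ _ (by norm_num)]
  congr 2
  simp only [enorm_eq_nnnorm, Complex.nnnorm_real]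

lemma memLp_exp_smul {H : Type*} [NormedAddCommGroup H] [InnerProductSpace ℂ H]
    (ρ : ℝ) (f : ℝ → H) (hf : MemLp f 2 (expMeasure ρ)) :
    MemLp (fun t => (Real.exp (-ρ * t) : ℂ) • f t) 2 volume := by
  refine ⟨?_, by rw [eLpNorm_expMeasure]; exact hf.2⟩
  exact AEStronglyMeasurable.smul (by fun_prop) (hf.1.mono_ac (volume_ac_expMeasure ρ))

lemma exp_smul_exp_smul {H : Type*} [NormedAddCommGroup H] [InnerProductSpace ℂ H]
    (ρ : ℝ) (f : ℝ → H) :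
    (fun t => (Real.exp (-ρ * t) : ℂ) • (Real.exp (ρ * t) : ℂ) • f t) = f := by
  funext t
  rw [smul_smul, ← Complex.ofReal_mul, ← Real.exp_add]
  simp

lemma memLp_exp_smul' {H : Type*} [NormedAddCommGroup H] [InnerProductSpace ℂ H]
    (ρ : ℝ) (f : ℝ → H) (hf : MemLp f 2 volume) :
    MemLp (fun t => (Real.exp (ρ * t) : ℂ) • f t) 2 (expMeasure ρ) := by
  refine ⟨?_, by rw [← eLpNorm_expMeasure, exp_smul_exp_smul]; exact hf.2⟩
  exact (AEStronglyMeasurable.smul (by fun_prop) hf.1).mono_ac (expMeasure_ac_volume ρ)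

lemma memLp_dilation {H : Type*} [NormedAddCommGroup H] [InnerProductSpace ℂ H]
    {a : ℝ} (ha : 0 < a) (f : ℝ → H) (hf : MemLp f 2 volume) :
    MemLp (fun t => (√a : ℂ) • f (a * t)) 2 volume := by
  have h : MemLp f 2 (Measure.map (a * ·) (volume : Measure ℝ)) := by
    rw [Real.map_volume_mul_left ha.ne']
    exact hf.smul_measure ENNReal.ofReal_ne_top
  exact (h.comp_of_map (by fun_prop)).const_smul _

lemma eLpNorm_dilation {H : Type*} [NormedAddCommGroup H] [InnerProductSpace ℂ H]
    {a : ℝ} (ha : 0 < a) (f : ℝ → H) :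
    eLpNorm (fun t => (√a : ℂ) • f (a * t)) 2 volume = eLpNorm f 2 volume := by
  have he : MeasurableEmbedding (a * · : ℝ → ℝ) :=
    (MeasurableEquiv.mulLeft₀ a ha.ne').measurableEmbedding
  have h1 : eLpNorm (fun t => f (a * t)) 2 volume
      = eLpNorm f 2 (Measure.map (a * ·) (volume : Measure ℝ)) :=
    (he.eLpNorm_map_measure).symm
  have h2 := eLpNorm_const_smul (√a : ℂ) (fun t => f (a * t)) 2 (volume : Measure ℝ)
  refine h2.trans ?_
  rw [h1, Real.map_volume_mul_left ha.ne', eLpNorm_smul_measure_of_ne_top (by simp),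
    smul_eq_mul, ← mul_assoc]
  have : ‖(√a : ℂ)‖ₑ * ENNReal.ofReal |a⁻¹| ^ (1 / 2 : ENNReal).toReal = 1 := by
    rw [← ofReal_norm, Complex.norm_real, Real.norm_of_nonneg (by positivity),
      abs_of_pos (by positivity), ENNReal.ofReal_rpow_of_pos (by positivity),
      ← ENNReal.ofReal_mul (by positivity), Real.sqrt_eq_rpow]
    simp only [one_div, ENNReal.toReal_inv, ENNReal.toReal_ofNat]
    rw [← Real.mul_rpow ha.le (by positivity), mul_inv_cancel₀ ha.ne']
    simp
  rw [this, one_mul]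

/-- A surjective isometry of spaces of functions, passed to equivalence classes. -/
def lpIsometryEquiv {H : Type*} [NormedAddCommGroup H] [InnerProductSpace ℂ H]
    {μ ν : Measure ℝ} (T : (ℝ → H) →ₗ[ℂ] (ℝ → H)) (S : (ℝ → H) → (ℝ → H))
    (hT : ∀ f, MemLp f 2 μ → MemLp (T f) 2 ν)
    (hn : ∀ f, eLpNorm (T f) 2 ν = eLpNorm f 2 μ)
    (hae : ∀ f g, f =ᵐ[μ] g → T f =ᵐ[ν] T g)
    (hS : ∀ f, MemLp f 2 ν → MemLp (S f) 2 μ)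
    (hTS : ∀ f, T (S f) = f) : Lp H 2 μ ≃ₗᵢ[ℂ] Lp H 2 ν :=
  LinearIsometryEquiv.ofSurjective
    { toFun := fun f => (hT f (Lp.memLp f)).toLp
      map_add' := fun f g => by
        rw [← MemLp.toLp_add]
        refine MemLp.toLp_congr _ _ ?_
        rw [← map_add]
        exact hae _ _ (Lp.coeFn_add f g)
      map_smul' := fun c f => by
        rw [RingHom.id_apply, ← MemLp.toLp_const_smul]
        refine MemLp.toLp_congr _ _ ?_
        rw [← map_smul]
        exact hae _ _ (Lp.coeFn_smul c f)
      norm_map' := fun f => by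
        have := Lp.norm_toLp (T f) (hT f (Lp.memLp f))
        rw [hn] at this
        exact this }
    fun g => by
      have hg := hS g (Lp.memLp g)
      refine ⟨hg.toLp, Lp.ext ((MemLp.coeFn_toLp (hT _ (Lp.memLp hg.toLp))).trans ?_)⟩
      refine (hae _ _ hg.coeFn_toLp).trans ?_
      rw [hTS]

lemma lpIsometryEquiv_toLp {H : Type*} [NormedAddCommGroup H] [InnerProductSpace ℂ H]
    {μ ν : Measure ℝ} (T : (ℝ → H) →ₗ[ℂ] (ℝ → H)) (S : (ℝ → H) → (ℝ → H))
    (hT : ∀ f, MemLp f 2 μ → MemLp (T f) 2 ν)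
    (hn : ∀ f, eLpNorm (T f) 2 ν = eLpNorm f 2 μ)
    (hae : ∀ f g, f =ᵐ[μ] g → T f =ᵐ[ν] T g)
    (hS : ∀ f, MemLp f 2 ν → MemLp (S f) 2 μ)
    (hTS : ∀ f, T (S f) = f) {f : ℝ → H} (hf : MemLp f 2 μ) :
    lpIsometryEquiv T S hT hn hae hS hTS hf.toLp = (hT f hf).toLp :=
  MemLp.toLp_congr (hT _ (Lp.memLp hf.toLp)) (hT f hf) (hae _ _ hf.coeFn_toLp)

/-! ### The Fourier–Laplace transform -/

/-- The unitary operator `exp (-ρ m)`, `f ↦ (t ↦ exp (-ρt) f(t))`, from `L_{2,ρ}(ℝ; H)` onto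
`L_2(ℝ; H)`. -/
def expMul (H : Type*) [NormedAddCommGroup H] [InnerProductSpace ℂ H] (ρ : ℝ) :
    L2 H ρ ≃ₗᵢ[ℂ] Lp H 2 (volume : Measure ℝ) :=
  lpIsometryEquiv
    { toFun := fun f t => (Real.exp (-ρ * t) : ℂ) • f t
      map_add' := fun f g => by funext t; simp
      map_smul' := fun c f => by funext t; simp [smul_comm c] }
    (fun f t => (Real.exp (ρ * t) : ℂ) • f t)
    (memLp_exp_smul ρ) (eLpNorm_expMeasure ρ)
    (fun f g h => by
      filter_upwards [(volume_ac_expMeasure ρ).ae_le h] with t ht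
      simp [ht])
    (memLp_exp_smul' ρ) (exp_smul_exp_smul ρ)

lemma inv_two_pi_pos : (0 : ℝ) < (2 * Real.pi)⁻¹ := by positivity

/-- The unitary operator `f ↦ (t ↦ (2π)^{-1/2} f(t/(2π)))` on `L_2(ℝ; H)`. It passes from the
normalisation `∫ exp (-2πits) f(s) ds` of the Fourier transform to
`(2π)^{-1/2} ∫ exp (-its) f(s) ds`. -/
def dilation (H : Type*) [NormedAddCommGroup H] [InnerProductSpace ℂ H] :
    Lp H 2 (volume : Measure ℝ) ≃ₗᵢ[ℂ] Lp H 2 (volume : Measure ℝ) :=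
  lpIsometryEquiv
    { toFun := fun f t => (√((2 * Real.pi)⁻¹) : ℂ) • f ((2 * Real.pi)⁻¹ * t)
      map_add' := fun f g => by funext t; simp
      map_smul' := fun c f => by funext t; simp [smul_comm c] }
    (fun f t => (√(2 * Real.pi) : ℂ) • f (2 * Real.pi * t))
    (memLp_dilation inv_two_pi_pos) (eLpNorm_dilation inv_two_pi_pos)
    (fun f g h => by
      have hq : Measure.QuasiMeasurePreserving ((2 * Real.pi)⁻¹ * · : ℝ → ℝ) volume volume := by
        refine ⟨by fun_prop, ?_⟩
        rw [Real.map_volume_mul_left inv_two_pi_pos.ne']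
        exact Measure.smul_absolutelyContinuous
      filter_upwards [hq.ae h] with t ht
      simp only [LinearMap.coe_mk, AddHom.coe_mk]
      rw [ht])
    (memLp_dilation (by positivity))
    (fun f => by
      have hp : (0 : ℝ) < 2 * Real.pi := by positivity
      funext t
      simp only [LinearMap.coe_mk, AddHom.coe_mk]
      rw [smul_smul, ← Complex.ofReal_mul, ← Real.sqrt_mul (by positivity),
        inv_mul_cancel₀ hp.ne', mul_inv_cancel_left₀ hp.ne']
      simp)

/-- The Fourier–Laplace transform `ℒ_ρ`, a unitary operator from `L_{2,ρ}(ℝ; H)` onto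
`L_2(ℝ; H)`. By `fourierLaplace_toLp` it is the continuous extension of
`φ ↦ (t ↦ (2π)^{-1/2} ∫ exp (-(it+ρ)s) φ(s) ds)`, `φ ∈ C_c^∞(ℝ; H)`. -/
def fourierLaplace (H : Type*) [NormedAddCommGroup H] [InnerProductSpace ℂ H] [CompleteSpace H]
    (ρ : ℝ) : L2 H ρ ≃ₗᵢ[ℂ] Lp H 2 (volume : Measure ℝ) :=
  ((expMul H ρ).trans (Lp.fourierTransformₗᵢ ℝ H)).trans (dilation H)

open scoped FourierTransform in
theorem fourierLaplace_toLp {H : Type*} [NormedAddCommGroup H] [InnerProductSpace ℂ H]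
    [CompleteSpace H] (ρ : ℝ) {φ : ℝ → H} (hφ : ContDiff ℝ ∞ φ) (hc : HasCompactSupport φ)
    (hm : MemLp φ 2 (expMeasure ρ)) :
    fourierLaplace H ρ hm.toLp =ᵐ[volume] fun t : ℝ =>
      ((√(2 * Real.pi))⁻¹ : ℂ) • ∫ s : ℝ, Complex.exp (-(Complex.I * t + ρ) * s) • φ s := by
  have hψ : ContDiff ℝ ∞ fun t => (Real.exp (-ρ * t) : ℂ) • φ t :=
    ContDiff.smul (Complex.ofRealCLM.contDiff.comp
      (Real.contDiff_exp.comp (contDiff_const.mul contDiff_id))) hφ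
  have hψc : HasCompactSupport fun t => (Real.exp (-ρ * t) : ℂ) • φ t := hc.smul_left
  set ψ : SchwartzMap ℝ H := hψc.toSchwartzMap hψ with hψd
  have h1 : expMul H ρ hm.toLp = ψ.toLp 2 := lpIsometryEquiv_toLp _ _ _ _ _ _ _ hm
  have h2 : fourierLaplace H ρ hm.toLp = dilation H ((𝓕 ψ).toLp 2) := by
    rw [← SchwartzMap.toLp_fourier_eq, ← h1]
    rfl
  have h3 : dilation H ((𝓕 ψ).toLp 2) =ᵐ[volume]
      fun t => (√((2 * Real.pi)⁻¹) : ℂ) • 𝓕 ψ ((2 * Real.pi)⁻¹ * t) := by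
    have h := (𝓕 ψ).memLp 2 volume
    have h4 : dilation H h.toLp = (memLp_dilation inv_two_pi_pos _ h).toLp :=
      lpIsometryEquiv_toLp _ _ _ _ _ _ _ h
    exact (congrArg (fun F : Lp H 2 (volume : Measure ℝ) => (F : ℝ → H)) h4).eventuallyEq.trans
      (MemLp.coeFn_toLp _)
  rw [h2]
  refine h3.trans (ae_of_all _ fun t => ?_)
  simp only [SchwartzMap.fourier_coe, Real.fourier_eq', hψd,
    HasCompactSupport.toSchwartzMap_toFun]
  rw [Real.sqrt_inv, Complex.ofReal_inv]
  congr 2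
  funext s
  rw [smul_smul, Complex.ofReal_exp, ← Complex.exp_add]
  congr 2
  have hp : (Real.pi : ℂ) ≠ 0 := by exact_mod_cast Real.pi_ne_zero
  simp only [RCLike.inner_apply, conj_trivial]
  push_cast
  field_simp
  ring

/-! ### The weighted Sobolev space `H^1_ρ(ℝ; H)` -/

/-- The graph of `φ ↦ φ'` on `C_c^∞(ℝ; H)`, as a subset of `L_{2,ρ}(ℝ; H) × L_{2,ρ}(ℝ; H)`. -/
def testDerivGraph (H : Type*) [NormedAddCommGroup H] [InnerProductSpace ℂ H] (ρ : ℝ) :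
    Set (L2 H ρ × L2 H ρ) :=
  {p | ∃ φ : ℝ → H, ContDiff ℝ ∞ φ ∧ HasCompactSupport φ ∧
    p.1 =ᵐ[volume] φ ∧ p.2 =ᵐ[volume] deriv φ}

/-- `H^1_ρ(ℝ; H)`: the domain of the closure `∂_{0,ρ}` of `φ ↦ φ'`, `φ ∈ C_c^∞(ℝ; H)`, whose
graph is the closure of the graph of this operator. -/
def H1 (H : Type*) [NormedAddCommGroup H] [InnerProductSpace ℂ H] (ρ : ℝ) : Set (L2 H ρ) :=
  {f | ∃ g : L2 H ρ, (f, g) ∈ closure (testDerivGraph H ρ)}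

/-- The class of the function `f` belongs to `H^1_ρ(ℝ; H)`. -/
def MemH1 {H : Type*} [NormedAddCommGroup H] [InnerProductSpace ℂ H] (ρ : ℝ) (f : ℝ → H) : Prop :=
  ∃ hf : MemLp f 2 (expMeasure ρ), hf.toLp ∈ H1 H ρ

/-! ### Linear operator pencils -/

section Pencil

variable {H : Type*} [NormedAddCommGroup H] [InnerProductSpace ℂ H]

/-- The linear operator pencil `ℳ(z) = z M₀ + M₁`. -/
def pencil (M₀ M₁ : H →L[ℂ] H) (z : ℂ) : H →L[ℂ] H := z • M₀ + M₁

/-- The spectrum of the pencil. -/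
def pencilSpectrum (M₀ M₁ : H →L[ℂ] H) : Set ℂ := {z | 0 ∈ spectrum ℂ (pencil M₀ M₁ z)}

/-- The resolvent set of the pencil. -/
def pencilResolventSet (M₀ M₁ : H →L[ℂ] H) : Set ℂ := (pencilSpectrum M₀ M₁)ᶜ

/-- `ℳ(z)⁻¹`; it is only used for `z` in the resolvent set. -/
def pencilInv (M₀ M₁ : H →L[ℂ] H) (z : ℂ) : H →L[ℂ] H := Ring.inverse (pencil M₀ M₁ z)

/-- The half-plane `Re z > ν` lies in the resolvent set and `z ↦ ℳ(z)⁻¹` is bounded on it. -/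
def IsRegularityBound (M₀ M₁ : H →L[ℂ] H) (ν : ℝ) : Prop :=
  {z : ℂ | ν < z.re} ⊆ pencilResolventSet M₀ M₁ ∧
    ∃ C : ℝ, ∀ z : ℂ, ν < z.re → ‖pencilInv M₀ M₁ z‖ ≤ C

/-- The pencil is regular (of index 0). -/
def IsRegularPencil (M₀ M₁ : H →L[ℂ] H) : Prop := ∃ ν : ℝ, IsRegularityBound M₀ M₁ ν

/-- `s₀(ℳ)`, as an extended real number: the infimum may be `-∞`. -/
def s₀ (M₀ M₁ : H →L[ℂ] H) : EReal :=
  sInf ((fun ν : ℝ => (ν : EReal)) '' {ν | IsRegularityBound M₀ M₁ ν})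

/-! ### The initial value problem -/

/-- The support of the class of `u` modulo equality almost everywhere: the complement of the
largest open set on which `u` vanishes almost everywhere. -/
def essSupport (u : ℝ → H) : Set ℝ :=
  {t | ∀ U ∈ 𝓝 t, ¬ ∀ᵐ s ∂(volume : Measure ℝ), s ∈ U → u s = 0}

/-- `(M₀ u)' + M₁ u = 0` on `(0, ∞)` in the sense of distributions. -/
def SolvesDistributionally (M₀ M₁ : H →L[ℂ] H) (u : ℝ → H) : Prop :=
  ∀ φ : ℝ → H, ContDiff ℝ ∞ φ → HasCompactSupport φ → tsupport φ ⊆ Set.Ioi 0 →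
    -(∫ t in Set.Ioi (0 : ℝ), inner ℂ (M₀ (u t)) (deriv φ t))
      + ∫ t in Set.Ioi (0 : ℝ), inner ℂ (M₁ (u t)) (φ t) = 0

/-- `lim_{t → 0+} (1/t) ∫_0^t |M₀ (u(s) - u₀)| ds = 0`. -/
def AttainsInitialValue (M₀ : H →L[ℂ] H) (u₀ : H) (u : ℝ → H) : Prop :=
  Tendsto (fun t : ℝ => (1 / t) * ∫ s in (0 : ℝ)..t, ‖M₀ (u s - u₀)‖) (𝓝[>] 0) (𝓝 0)

/-- `M₀ u(t) + ∫_0^t M₁ u(s) ds = M₀ u₀` for almost every `t > 0`. -/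
def SolvesIntegrated (M₀ M₁ : H →L[ℂ] H) (u₀ : H) (u : ℝ → H) : Prop :=
  ∀ᵐ t ∂(volume : Measure ℝ), 0 < t → M₀ (u t) + ∫ s in (0 : ℝ)..t, M₁ (u s) = M₀ u₀

/-- Mild solutions with initial value `u₀`, for classes of locally integrable functions on `ℝ`
supported in `[0, ∞)`. The condition `(M₀ u)(0+) = M₀ u₀` is read modulo null sets. -/
def IsMildSolution (M₀ M₁ : H →L[ℂ] H) (u₀ : H) (u : ℝ → H) : Prop :=
  LocallyIntegrable u volume ∧ essSupport u ⊆ Set.Ici 0 ∧ SolvesIntegrated M₀ M₁ u₀ u ∧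
    Tendsto (fun t => M₀ (u t)) (𝓝[>] (0 : ℝ) ⊓ ae volume) (𝓝 (M₀ u₀))

/-- `u ∈ L_{2,ρ}(ℝ; H)` and `(ℒ_ρ u)(t) = (2π)^{-1/2} ((it+ρ) M₀ + M₁)⁻¹ M₀ u₀`. -/
def HasLaplaceRepresentation [CompleteSpace H] (M₀ M₁ : H →L[ℂ] H) (u₀ : H) (u : ℝ → H)
    (ρ : ℝ) : Prop :=
  ∃ hu : MemLp u 2 (expMeasure ρ),
    fourierLaplace H ρ hu.toLp =ᵐ[volume] fun t : ℝ =>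
      ((√(2 * Real.pi))⁻¹ : ℂ) • pencilInv M₀ M₁ (Complex.I * t + ρ) (M₀ u₀)

end Pencil

end DAE

end

/-!
Everything is compared with one explicit solution, the inverse Fourier–Laplace transform of
`z ↦ ℳ(z)⁻¹ M₀ u₀` on a vertical line `Re z = ρ`.

*Existence.* Since `z ℳ(z)⁻¹ M₀ = 1 - ℳ(z)⁻¹ M₁`, the function `ℳ(z)⁻¹ M₀ u₀` is `O(1 / |z|)`, so it
is square integrable on vertical lines and has an inverse transform `u ∈ L_{2,ρ}`. Tested against
`φ ∈ C_c^∞(ℝ)`, this `u` is given by a vertical integral of the holomorphic function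
`Φ(z) ℳ(z)⁻¹ M₀ u₀`, where `Φ(z) = ∫ exp (zs) φ(s) ds` decays rapidly
(`HasLaplaceRepresentation.integral_smul`). Cauchy's theorem shows that `u` does not depend on `ρ`
(`HasLaplaceRepresentation.ae_eq_of_le`), and since its norm in `L_{2,ρ}` is bounded as `ρ → ∞`, it
vanishes on the negative half-line. In the same weak form `(z M₀ + M₁) ℳ(z)⁻¹ M₀ u₀ = M₀ u₀` becomes
`(M₀ u)' + M₁ u = M₀ u₀ δ₀`, which is the integrated equation
(`HasLaplaceRepresentation.solvesIntegrated`).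

*Uniqueness* holds among all locally integrable functions, without a growth condition. If
`M₀ u + ∫_0^t M₁ u = 0`, then `F(z) = ∫_0^T exp (z (T - s)) u(s) ds` satisfies
`ℳ(z) F(z) = ∫_0^T M₁ u`. So `F` is bounded on a right half-plane, by regularity of the pencil, and
on the complementary left half-plane, where `exp (z (T - s))` is bounded; by Liouville's theorem it
is constant, hence equal to its limit `0` at `-∞` (`truncatedLaplace_eq_zero`). At `z = 0` this
reads `∫_0^T u = 0`, for every `T`.

*The distributional equation* is equivalent to the integrated one by the lemma of du Bois-Reymond
and integration by parts; the initial condition identifies the constant of integration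
(`solvesIntegrated_iff`).

*Regularity.* The function `M₀ (u - χ u₀)` is the primitive of `-M₁ u ∈ L_{2,ρ}`. For `ρ > 0`
integration from `-∞` is bounded on `L_{2,ρ}` and the derivatives of test functions are dense, so
every such primitive belongs to `H^1_ρ` (`memH1_of_ae_eq_primitive`).
-/

namespace DAE

/-! ### Functions supported in a half-line -/

lemma essSupport_subset_Ici_iff {H : Type*} [NormedAddCommGroup H]
    {u : ℝ → H} : essSupport u ⊆ Set.Ici 0 ↔ ∀ᵐ t ∂(volume : Measure ℝ), t < 0 → u t = 0 := by
  constructor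
  · intro h
    have h0 : volume {t : ℝ | t < 0 ∧ u t ≠ 0} = 0 := by
      refine measure_null_of_locally_null _ fun t ht => ?_
      have h1 : t ∉ essSupport u := fun h2 => not_le.2 ht.1 (h h2)
      simp only [essSupport, Set.mem_ofPred_eq, not_forall, not_not] at h1
      obtain ⟨U, hU, hU0⟩ := h1
      refine ⟨U ∩ {t : ℝ | t < 0 ∧ u t ≠ 0}, inter_mem (mem_nhdsWithin_of_mem_nhds hU)
        self_mem_nhdsWithin, measure_mono_null ?_ (ae_iff.1 hU0)⟩
      rintro s ⟨hs, -, hs'⟩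
      simpa using ⟨hs, hs'⟩
    rw [ae_iff]
    simpa using h0
  · intro h t ht
    by_contra hlt
    exact ht (Set.Iio 0) (Iio_mem_nhds (not_le.1 hlt)) h

lemma intervalIntegrable_of_locallyIntegrable {E : Type*} [NormedAddCommGroup E] {u : ℝ → E}
    (hu : LocallyIntegrable u) (a b : ℝ) : IntervalIntegrable u volume a b :=
  (hu.integrableOn_isCompact isCompact_uIcc).intervalIntegrable

/-! ### Integration by parts and the lemma of du Bois-Reymond -/

/-- Integration by parts for a `C¹` function and the primitive of an integrable function, which
need not be differentiable everywhere; the identity is an instance of Fubini's theorem on the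
triangle `a < s ≤ t ≤ b`. -/
lemma integral_deriv_bilin_primitive {E F G : Type*} [NormedAddCommGroup E] [NormedSpace ℝ E]
    [CompleteSpace E] [NormedAddCommGroup F] [NormedSpace ℝ F] [CompleteSpace F]
    [NormedAddCommGroup G] [NormedSpace ℝ G] [CompleteSpace G] (B : F →L[ℝ] E →L[ℝ] G)
    {φ φ' : ℝ → F} {g : ℝ → E} {a b : ℝ}
    (hab : a ≤ b) (hφ : ∀ t, HasDerivAt φ (φ' t) t) (hφ' : Continuous φ')
    (hg : IntegrableOn g (Set.Ioc a b)) :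
    ∫ t in a..b, B (φ' t) (∫ s in a..t, g s)
      = B (φ b) (∫ s in a..b, g s) - ∫ t in a..b, B (φ t) (g t) := by
  have hcont : Continuous φ := continuous_iff_continuousAt.2 fun t => (hφ t).continuousAt
  have hφi : IntegrableOn φ' (Set.Ioc a b) := hφ'.integrableOn_Ioc
  have hφg : IntegrableOn (fun t => B (φ t) (g t)) (Set.Ioc a b) := by
    obtain ⟨C, hC⟩ := isCompact_Icc.exists_bound_of_continuousOn (s := Set.Icc a b)
      hcont.continuousOn
    refine Integrable.mono' (hg.norm.const_mul (‖B‖ * C))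
      (B.aestronglyMeasurable_comp₂ hcont.aestronglyMeasurable hg.1) ?_
    filter_upwards [ae_restrict_mem measurableSet_Ioc] with t ht
    exact (B.le_opNorm₂ _ _).trans (by gcongr; exact hC t (Set.Ioc_subset_Icc_self ht))
  set F : ℝ × ℝ → G := {p : ℝ × ℝ | p.2 ≤ p.1}.indicator (fun p => B (φ' p.1) (g p.2)) with hF
  have hFi : Integrable F
      ((volume.restrict (Set.Ioc a b)).prod (volume.restrict (Set.Ioc a b))) := by
    refine Integrable.indicator ?_ (measurableSet_le measurable_snd measurable_fst)
    refine Integrable.mono' ((Integrable.mul_prod hφi.norm hg.norm).const_mul ‖B‖)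
      (B.aestronglyMeasurable_comp₂ hφi.1.comp_fst hg.1.comp_snd) (ae_of_all _ fun p => ?_)
    rw [← mul_assoc]
    exact B.le_opNorm₂ _ _
  have h1 : ∀ t ∈ Set.Ioc a b, B (φ' t) (∫ s in a..t, g s) = ∫ s in Set.Ioc a b, F (t, s) := by
    intro t ht
    have : (fun s => F (t, s)) = (Set.Iic t).indicator (fun s => B (φ' t) (g s)) := by
      funext s; simp [hF, Set.indicator]
    rw [this, setIntegral_indicator measurableSet_Iic, Set.Ioc_inter_Iic, min_eq_right ht.2,
      intervalIntegral.integral_of_le ht.1.le, (B (φ' t)).integral_comp_comm]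
    exact hg.mono_set (Set.Ioc_subset_Ioc_right ht.2)
  have h2 : ∀ s ∈ Set.Ioc a b,
      ∫ t in Set.Ioc a b, F (t, s) = B (φ b) (g s) - B (φ s) (g s) := by
    intro s hs
    have : (fun t => F (t, s)) = (Set.Ici s).indicator (fun t => B.flip (g s) (φ' t)) := by
      funext t; simp [hF, Set.indicator]
    rw [this, setIntegral_indicator measurableSet_Ici]
    have h3 : Set.Ioc a b ∩ Set.Ici s = Set.Icc s b := by
      ext t; simp only [Set.mem_inter_iff, Set.mem_Ioc, Set.mem_Ici, Set.mem_Icc]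
      exact ⟨fun h => ⟨h.2, h.1.2⟩, fun h => ⟨⟨hs.1.trans_le h.1, h.2⟩, h.1⟩⟩
    rw [h3, integral_Icc_eq_integral_Ioc, (B.flip (g s)).integral_comp_comm hφ'.integrableOn_Ioc,
      ← intervalIntegral.integral_of_le hs.2,
      intervalIntegral.integral_eq_sub_of_hasDerivAt (fun t _ => hφ t)
        (hφ'.intervalIntegrable _ _)]
    simp
  rw [intervalIntegral.integral_of_le hab, intervalIntegral.integral_of_le hab,
    intervalIntegral.integral_of_le hab, setIntegral_congr_fun measurableSet_Ioc h1,
    integral_integral_swap (f := fun t s => F (t, s)) hFi,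
    setIntegral_congr_fun measurableSet_Ioc h2,
    integral_sub (f := fun t => B (φ b) (g t)) ((B (φ b)).integrable_comp hg) hφg,
    (B (φ b)).integral_comp_comm hg]

lemma integral_deriv_smul_primitive {𝕜 E : Type*} [RCLike 𝕜] [NormedAddCommGroup E]
    [NormedSpace ℝ E] [NormedSpace 𝕜 E] [IsScalarTower ℝ 𝕜 E] [CompleteSpace E] {φ φ' : ℝ → 𝕜}
    {g : ℝ → E} {a b : ℝ} (hab : a ≤ b) (hφ : ∀ t, HasDerivAt φ (φ' t) t) (hφ' : Continuous φ')
    (hg : IntegrableOn g (Set.Ioc a b)) :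
    ∫ t in a..b, φ' t • ∫ s in a..t, g s = φ b • (∫ s in a..b, g s) - ∫ t in a..b, φ t • g t :=
  integral_deriv_bilin_primitive (ContinuousLinearMap.lsmul ℝ 𝕜) hab hφ hφ' hg

/-- A test function with vanishing integral is the derivative of a test function, whose support
lies in the same interval. -/
lemma exists_primitive_of_integral_eq_zero {E : Type*} [NormedAddCommGroup E] [NormedSpace ℝ E]
    [CompleteSpace E] {φ : ℝ → E} (hφ : ContDiff ℝ ∞ φ) {l r : ℝ}
    (hs : tsupport φ ⊆ Set.Icc l r) (h0 : ∫ t, φ t = 0) :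
    ∃ ψ : ℝ → E, ContDiff ℝ ∞ ψ ∧ HasCompactSupport ψ ∧ tsupport ψ ⊆ Set.Icc l r ∧
      deriv ψ = φ ∧ ∀ t, ψ t = ∫ s in Set.Iic t, φ s := by
  have hz : ∀ t, t ∉ Set.Icc l r → φ t = 0 := fun t ht =>
    image_eq_zero_of_notMem_tsupport fun h => ht (hs h)
  have hc : HasCompactSupport φ := isCompact_Icc.of_isClosed_subset (isClosed_tsupport φ) hs
  have hi : Integrable φ := hφ.continuous.integrable_of_hasCompactSupport hc
  have hd : ∀ t, HasDerivAt (fun t => ∫ s in Set.Iic t, φ s) (φ t) t := by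
    intro t
    have h1 : (fun t => ∫ s in Set.Iic t, φ s) =
        fun t => (∫ s in Set.Iic 0, φ s) + ∫ s in (0 : ℝ)..t, φ s := by
      funext t
      rw [← intervalIntegral.integral_Iic_sub_Iic hi.integrableOn hi.integrableOn]
      abel
    rw [h1]
    exact (intervalIntegral.integral_hasDerivAt_right (hφ.continuous.intervalIntegrable _ _)
      (hφ.continuous.stronglyMeasurableAtFilter _ _) hφ.continuous.continuousAt).const_add _
  have hsupp : tsupport (fun t => ∫ s in Set.Iic t, φ s) ⊆ Set.Icc l r := by
    refine closure_minimal (fun t ht => ?_) isClosed_Icc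
    by_contra hn
    apply ht
    rw [Set.mem_Icc, not_and_or, not_le, not_le] at hn
    rcases hn with hn | hn
    · refine setIntegral_eq_zero_of_forall_eq_zero fun s hs => hz s fun h => ?_
      exact absurd (h.1.trans hs) (not_le.2 hn)
    · change ∫ s in Set.Iic t, φ s = 0
      rw [setIntegral_eq_integral_of_forall_compl_eq_zero, h0]
      intro s hs
      exact hz s fun h => hs (h.2.trans hn.le)
  refine ⟨fun t => ∫ s in Set.Iic t, φ s, ?_,
    isCompact_Icc.of_isClosed_subset (isClosed_tsupport _) hsupp, hsupp,
    funext fun t => (hd t).deriv, fun t => rfl⟩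
  rw [contDiff_infty_iff_deriv]
  refine ⟨fun t => (hd t).differentiableAt, ?_⟩
  rwa [funext fun t => (hd t).deriv]

lemma exists_Icc_of_tsupport_subset_Ioi {E : Type*} [Zero E] {φ : ℝ → E} {a : ℝ}
    (hc : HasCompactSupport φ) (hs : tsupport φ ⊆ Set.Ioi a) :
    ∃ l r, a < l ∧ l ≤ r ∧ tsupport φ ⊆ Set.Icc l r := by
  rcases (tsupport φ).eq_empty_or_nonempty with h | h
  · exact ⟨a + 1, a + 1, by linarith, le_rfl, by simp [h]⟩
  · exact ⟨sInf (tsupport φ), sSup (tsupport φ), hs (hc.isCompact.sInf_mem h),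
      csInf_le_csSup h hc.isCompact.bddBelow hc.isCompact.bddAbove, fun t ht =>
        ⟨csInf_le hc.isCompact.bddBelow ht, le_csSup hc.isCompact.bddAbove ht⟩⟩

lemma integrable_smul_of_hasCompactSupport {𝕜 E : Type*} [RCLike 𝕜] [NormedAddCommGroup E]
    [NormedSpace 𝕜 E] {φ : ℝ → 𝕜} {w : ℝ → E} (hφ : Continuous φ) (hc : HasCompactSupport φ)
    (hw : LocallyIntegrable w) : Integrable fun t => φ t • w t :=
  hw.integrable_smul_left_of_hasCompactSupport hφ hc

/-- The lemma of du Bois-Reymond on a half-line. -/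
lemma exists_ae_eq_const_of_integral_deriv_smul_eq_zero {E : Type*} [NormedAddCommGroup E]
    [NormedSpace ℝ E] [CompleteSpace E] {w : ℝ → E} {a : ℝ} (hw : LocallyIntegrable w)
    (h : ∀ ψ : ℝ → ℝ, ContDiff ℝ ∞ ψ → HasCompactSupport ψ → tsupport ψ ⊆ Set.Ioi a →
      ∫ t, deriv ψ t • w t = 0) :
    ∃ c : E, ∀ᵐ t ∂(volume : Measure ℝ), a < t → w t = c := by
  -- A bump of mass one supported in `[a + 1, a + 3]`; the constant is the mean of `w` against it.
  let b : ContDiffBump (a + 2) := ⟨1 / 2, 1, by norm_num, by norm_num⟩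
  set η : ℝ → ℝ := b.normed volume with hη
  have hηd : ContDiff ℝ ∞ η := b.contDiff_normed
  have hηs : tsupport η ⊆ Set.Icc (a + 1) (a + 3) := by
    rw [hη, b.tsupport_normed_eq, Real.closedBall_eq_Icc]
    refine Set.Icc_subset_Icc ?_ ?_ <;> simp [b] <;> linarith
  have hηc : HasCompactSupport η := b.hasCompactSupport_normed
  have hη1 : ∫ t, η t = 1 := b.integral_normed
  refine ⟨∫ t, η t • w t, ?_⟩
  have key := isOpen_Ioi.ae_eq_zero_of_integral_contDiff_smul_eq_zero (U := Set.Ioi a)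
    (f := fun t => w t - ∫ t, η t • w t) (μ := volume)
    ((hw.sub (locallyIntegrable_const _)).locallyIntegrableOn _) ?_
  · filter_upwards [key] with t ht hat
    exact sub_eq_zero.1 (ht hat)
  · intro φ hφ hφc hφs
    obtain ⟨l, r, hl, hlr, hs⟩ := exists_Icc_of_tsupport_subset_Ioi hφc hφs
    set m := ∫ t, φ t with hm
    have hφi : Integrable φ := hφ.continuous.integrable_of_hasCompactSupport hφc
    have hηi : Integrable η := hηd.continuous.integrable_of_hasCompactSupport hηc
    -- `φ - m η` has mean zero, so it is the derivative of a test function supported in `(a, ∞)`.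
    obtain ⟨ψ, hψ, hψc, hψs, hψd, -⟩ := exists_primitive_of_integral_eq_zero
      (φ := fun t => φ t - m * η t) (l := min l (a + 1)) (r := max r (a + 3))
      (hφ.sub (contDiff_const.mul hηd)) (by
        refine closure_minimal (fun t ht => ?_) isClosed_Icc
        by_cases h1 : t ∈ tsupport φ
        · exact Set.Icc_subset_Icc (min_le_left _ _) (le_max_left _ _) (hs h1)
        · have h2 : t ∈ tsupport η := by
            by_contra h2
            exact ht (by simp [image_eq_zero_of_notMem_tsupport h1,
              image_eq_zero_of_notMem_tsupport h2])
          exact Set.Icc_subset_Icc (min_le_right _ _) (le_max_right _ _) (hηs h2))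
      (by rw [integral_sub hφi (hηi.const_mul m), integral_const_mul, hη1, mul_one, sub_self])
    have h1 := h ψ hψ hψc (hψs.trans fun t ht =>
      lt_of_lt_of_le (lt_min hl (by linarith)) ht.1)
    have h2 : Integrable fun t => φ t • w t :=
      integrable_smul_of_hasCompactSupport hφ.continuous hφc hw
    have h3 : Integrable fun t => η t • w t :=
      integrable_smul_of_hasCompactSupport hηd.continuous hηc hw
    simp only [hψd, sub_smul, mul_smul] at h1
    rw [integral_sub (g := fun t => m • η t • w t) h2 (h3.smul m), integral_smul] at h1
    simp only [smul_sub]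
    rw [integral_sub (g := fun t => φ t • ∫ t, η t • w t) h2 (hφi.smul_const _),
      integral_smul_const]
    exact h1

lemma locallyIntegrable_primitive {E : Type*} [NormedAddCommGroup E] [NormedSpace ℝ E]
    {g : ℝ → E} (hg : LocallyIntegrable g) : LocallyIntegrable fun t => ∫ s in (0 : ℝ)..t, g s :=
  (intervalIntegral.continuous_primitive
    (fun a b => intervalIntegrable_of_locallyIntegrable hg a b) 0).locallyIntegrable

/-- Integration by parts on the whole line, for a compactly supported `C¹` function. -/
lemma integral_deriv_smul_primitive_of_hasCompactSupport {E : Type*} [NormedAddCommGroup E]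
    [NormedSpace ℝ E] [CompleteSpace E] {ψ : ℝ → ℝ} {g : ℝ → E} (hψ : ContDiff ℝ ∞ ψ)
    (hc : HasCompactSupport ψ) (hg : LocallyIntegrable g) :
    ∫ t, deriv ψ t • ∫ s in (0 : ℝ)..t, g s = -∫ t, ψ t • g t := by
  obtain ⟨R, hR0, hR⟩ : ∃ R : ℝ, 0 < R ∧ tsupport ψ ⊆ Set.Icc (-R) R := by
    obtain ⟨R, hR0, hR⟩ := hc.isCompact.isBounded.subset_closedBall_lt 0 0
    exact ⟨R, hR0, by simpa [Real.closedBall_eq_Icc] using hR⟩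
  have hsub : tsupport ψ ⊆ Set.Ioc (-R - 1) (R + 1) := fun t ht =>
    ⟨by linarith [(hR ht).1], by linarith [(hR ht).2]⟩
  have hz : ∀ t, t ∉ tsupport ψ → ψ t = 0 ∧ deriv ψ t = 0 := fun t ht =>
    ⟨image_eq_zero_of_notMem_tsupport ht,
      image_eq_zero_of_notMem_tsupport fun h => ht (tsupport_deriv_subset h)⟩
  have hle : -R - 1 ≤ R + 1 := by linarith
  have hd : ∀ t, HasDerivAt ψ (deriv ψ t) t := fun t =>
    ((hψ.differentiable (by simp)) t).hasDerivAt
  have hψ' : Continuous (deriv ψ) := hψ.continuous_deriv (by simp)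
  have hI : ∀ f : ℝ → E, (∀ t, t ∉ tsupport ψ → f t = 0) →
      ∫ t, f t = ∫ t in (-R - 1)..(R + 1), f t := fun f hf => by
    rw [intervalIntegral.integral_of_le hle, setIntegral_eq_integral_of_forall_compl_eq_zero]
    exact fun t ht => hf t fun h => ht (hsub h)
  have hgi := intervalIntegrable_of_locallyIntegrable hg
  have hp := integral_deriv_smul_primitive (g := g) hle hd hψ'
    ((intervalIntegrable_iff_integrableOn_Ioc_of_le hle).1 (hgi _ _))
  have hψR : ψ (R + 1) = 0 := (hz _ fun h => by linarith [(hR h).2]).1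
  rw [hψR, zero_smul, zero_sub] at hp
  rw [hI _ fun t ht => by simp [(hz t ht).2], hI _ fun t ht => by simp [(hz t ht).1], ← hp]
  have h1 : ∀ t, ∫ s in (0 : ℝ)..t, g s = (∫ s in (-R - 1)..t, g s) - ∫ s in (-R - 1)..0, g s :=
    fun t => (intervalIntegral.integral_interval_sub_left (hgi _ _) (hgi _ _)).symm
  have h2 : Continuous fun t => ∫ s in (-R - 1)..t, g s :=
    intervalIntegral.continuous_primitive hgi _
  simp only [h1, smul_sub]
  rw [intervalIntegral.integral_sub (f := fun t => deriv ψ t • ∫ s in (-R - 1)..t, g s)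
    (g := fun t => deriv ψ t • ∫ s in (-R - 1)..0, g s) ((hψ'.smul h2).intervalIntegrable _ _)
    ((hψ'.smul continuous_const).intervalIntegrable _ _), intervalIntegral.integral_smul_const,
    intervalIntegral.integral_eq_sub_of_hasDerivAt (fun t _ => hd t)
      (hψ'.intervalIntegrable _ _), hψR, (hz (-R - 1) fun h => by linarith [(hR h).1]).1]
  simp

/-- If `p' = -g` on `(a, ∞)` in the sense of distributions, then `p` differs from the primitive
of `-g` by a constant. -/
lemma exists_ae_add_primitive_eq_const {E : Type*} [NormedAddCommGroup E] [NormedSpace ℝ E]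
    [CompleteSpace E] {p g : ℝ → E} {a : ℝ} (hp : LocallyIntegrable p) (hg : LocallyIntegrable g)
    (h : ∀ ψ : ℝ → ℝ, ContDiff ℝ ∞ ψ → HasCompactSupport ψ → tsupport ψ ⊆ Set.Ioi a →
      ∫ t, deriv ψ t • p t = ∫ t, ψ t • g t) :
    ∃ c : E, ∀ᵐ t ∂(volume : Measure ℝ), a < t → p t + ∫ s in (0 : ℝ)..t, g s = c := by
  have hG := locallyIntegrable_primitive hg
  refine exists_ae_eq_const_of_integral_deriv_smul_eq_zero (hp.add hG) fun ψ hψ hc hs => ?_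
  have hψ' : Continuous (deriv ψ) := hψ.continuous_deriv (by simp)
  simp only [smul_add]
  rw [integral_add (integrable_smul_of_hasCompactSupport hψ' hc.deriv hp)
    (integrable_smul_of_hasCompactSupport hψ' hc.deriv hG), h ψ hψ hc hs,
    integral_deriv_smul_primitive_of_hasCompactSupport hψ hc hg, add_neg_cancel]

/-! ### The resolvent of a regular pencil -/

section Resolvent

variable {H : Type*} [NormedAddCommGroup H] [InnerProductSpace ℂ H] {M₀ M₁ : H →L[ℂ] H}
  {ν : ℝ} {z : ℂ}

lemma IsRegularityBound.isUnit_pencil (hν : IsRegularityBound M₀ M₁ ν) (hz : ν < z.re) :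
    IsUnit (pencil M₀ M₁ z) := by
  have h := hν.1 hz
  simpa [pencilResolventSet, pencilSpectrum, spectrum.mem_iff] using h

lemma IsRegularityBound.pencilInv_pencil (hν : IsRegularityBound M₀ M₁ ν) (hz : ν < z.re)
    (x : H) : pencilInv M₀ M₁ z (pencil M₀ M₁ z x) = x :=
  DFunLike.congr_fun (Ring.inverse_mul_cancel _ (hν.isUnit_pencil hz)) x

lemma IsRegularityBound.pencil_pencilInv (hν : IsRegularityBound M₀ M₁ ν) (hz : ν < z.re)
    (x : H) : pencil M₀ M₁ z (pencilInv M₀ M₁ z x) = x :=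
  DFunLike.congr_fun (Ring.mul_inverse_cancel _ (hν.isUnit_pencil hz)) x

lemma exists_isRegularityBound_lt {ρ : ℝ} (h : max (s₀ M₀ M₁) 0 < (ρ : EReal)) :
    0 < ρ ∧ ∃ ν < ρ, IsRegularityBound M₀ M₁ ν := by
  rw [max_lt_iff] at h
  refine ⟨by exact_mod_cast h.2, ?_⟩
  obtain ⟨_, ⟨ν, hν, rfl⟩, hlt⟩ := sInf_lt_iff.1 h.1
  exact ⟨ν, EReal.coe_lt_coe_iff.1 hlt, hν⟩

lemma IsRegularityBound.max_s₀_lt (hν : IsRegularityBound M₀ M₁ ν) {ρ : ℝ} (h : ν < ρ)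
    (h0 : 0 < ρ) : max (s₀ M₀ M₁) 0 < (ρ : EReal) :=
  max_lt ((sInf_le ⟨ν, hν, rfl⟩ : s₀ M₀ M₁ ≤ (ν : EReal)).trans_lt (EReal.coe_lt_coe_iff.2 h))
    (by exact_mod_cast h0)

/-- On the range of `M₀` the resolvent gains a power of `z`, by
`z ℳ(z)⁻¹ M₀ = 1 - ℳ(z)⁻¹ M₁`. -/
lemma IsRegularityBound.exists_norm_pencilInv_le (hν : IsRegularityBound M₀ M₁ ν) (x : H) :
    ∃ C, 0 ≤ C ∧ ∀ z : ℂ, ν < z.re → 0 < z.re → ‖pencilInv M₀ M₁ z (M₀ x)‖ ≤ C / ‖z‖ := by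
  obtain ⟨C, hC⟩ := hν.2
  refine ⟨‖x‖ + |C| * ‖M₁ x‖, by positivity, fun z hz h0 => ?_⟩
  have hz0 : z ≠ 0 := by rintro rfl; simp at h0
  rw [le_div_iff₀ (norm_pos_iff.2 hz0), mul_comm, ← norm_smul]
  have h1 : z • pencilInv M₀ M₁ z (M₀ x) = x - pencilInv M₀ M₁ z (M₁ x) := by
    have := hν.pencilInv_pencil hz x
    simp only [pencil, add_apply, smul_apply, map_add,
      map_smul] at this
    exact eq_sub_iff_add_eq.2 this
  rw [h1]
  refine (norm_sub_le _ _).trans (add_le_add_right ?_ _)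
  exact (ContinuousLinearMap.le_opNorm _ _).trans
    (mul_le_mul_of_nonneg_right ((hC z hz).trans (le_abs_self C)) (norm_nonneg _))

variable [CompleteSpace H]

lemma IsRegularityBound.differentiableAt_pencilInv (hν : IsRegularityBound M₀ M₁ ν)
    (hz : ν < z.re) : DifferentiableAt ℂ (pencilInv M₀ M₁) z := by
  have h : DifferentiableAt ℂ (pencil M₀ M₁) z := by
    unfold pencil
    fun_prop
  exact (differentiableAt_inverse (hν.isUnit_pencil hz)).comp z h

end Resolvent

/-! ### Uniqueness -/

section Uniqueness

variable {H : Type*} [NormedAddCommGroup H] [InnerProductSpace ℂ H]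
  {M₀ M₁ : H →L[ℂ] H}

/-- The Laplace integral of `u` over `(0, T)`, multiplied by `exp (zT)`. -/
noncomputable def truncatedLaplace (u : ℝ → H) (T : ℝ) (z : ℂ) : H :=
  ∫ s in (0 : ℝ)..T, Complex.exp (z * (T - s)) • u s

lemma norm_cexp_mul_sub (z : ℂ) (T s : ℝ) :
    ‖Complex.exp (z * (T - s))‖ = Real.exp (z.re * (T - s)) := by
  rw [Complex.norm_exp]
  congr 1
  rw [← Complex.ofReal_sub, Complex.re_mul_ofReal]

lemma differentiable_truncatedLaplace {u : ℝ → H} (hu : LocallyIntegrable u) {T : ℝ}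
    (hT : 0 ≤ T) : Differentiable ℂ (truncatedLaplace u T) := by
  intro z
  have hi : IntegrableOn u (Set.Ioc 0 T) :=
    (hu.integrableOn_isCompact isCompact_Icc).mono_set Set.Ioc_subset_Icc_self
  have hi' : IntervalIntegrable u volume 0 T :=
    (intervalIntegrable_iff_integrableOn_Ioc_of_le hT).2 hi
  have hcont : ∀ w : ℂ, Continuous fun s : ℝ => Complex.exp (w * (T - s)) := fun w => by fun_prop
  refine (intervalIntegral.hasDerivAt_integral_of_dominated_loc_of_deriv_le
    (F := fun w s => Complex.exp (w * (T - s)) • u s)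
    (F' := fun w s => (Complex.exp (w * (T - s)) * (T - s)) • u s)
    (bound := fun s => (Real.exp ((‖z‖ + 1) * T) * T) * ‖u s‖)
    (Metric.ball_mem_nhds z one_pos) ?_ ?_ ?_ ?_ ?_ ?_).2.differentiableAt
  · exact Eventually.of_forall fun w =>
      (hcont w).aestronglyMeasurable.smul (by rw [Set.uIoc_of_le hT]; exact hi.1)
  · exact hi'.continuousOn_smul (hcont z).continuousOn
  · refine AEStronglyMeasurable.smul (Continuous.aestronglyMeasurable (by fun_prop))
      (by rw [Set.uIoc_of_le hT]; exact hi.1)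
  · refine ae_of_all _ fun s hs w hw => ?_
    rw [Set.uIoc_of_le hT] at hs
    have hs0 : 0 ≤ T - s := by linarith [hs.2]
    rw [norm_smul, norm_mul, norm_cexp_mul_sub, ← Complex.ofReal_sub, Complex.norm_real,
      Real.norm_of_nonneg hs0]
    have hw1 : w.re ≤ ‖z‖ + 1 := by
      have h1 := Complex.re_le_norm w
      have h2 := norm_le_norm_add_norm_sub' w z
      rw [mem_ball_iff_norm] at hw
      linarith
    have h3 : w.re * (T - s) ≤ (‖z‖ + 1) * T :=
      mul_le_mul hw1 (by linarith [hs.1]) hs0 (by positivity)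
    refine mul_le_mul_of_nonneg_right ?_ (norm_nonneg _)
    exact mul_le_mul (Real.exp_le_exp.2 h3) (by linarith [hs.1]) hs0 (Real.exp_pos _).le
  · exact hi'.norm.const_mul _
  · refine ae_of_all _ fun s _ w _ => ?_
    have h : HasDerivAt (fun w : ℂ => w * ((T : ℂ) - s)) ((T : ℂ) - s) w := by
      simpa using (hasDerivAt_id w).mul_const ((T : ℂ) - s)
    exact h.cexp.smul_const _

lemma norm_truncatedLaplace_le {u : ℝ → H} (hu : LocallyIntegrable u) {T R : ℝ}
    (hT : 0 ≤ T) (hR : 0 ≤ R) {z : ℂ} (hz : z.re ≤ R) :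
    ‖truncatedLaplace u T z‖ ≤ Real.exp (R * T) * ∫ s in (0 : ℝ)..T, ‖u s‖ := by
  have hi' : IntervalIntegrable u volume 0 T := intervalIntegrable_of_locallyIntegrable hu _ _
  rw [← intervalIntegral.integral_const_mul]
  refine intervalIntegral.norm_integral_le_of_norm_le hT (ae_of_all _ fun s hs => ?_)
    (hi'.norm.const_mul _)
  rw [norm_smul, norm_cexp_mul_sub]
  refine mul_le_mul_of_nonneg_right (Real.exp_le_exp.2 ?_) (norm_nonneg _)
  have hs0 : 0 ≤ T - s := by linarith [hs.2]
  exact (mul_le_mul_of_nonneg_right hz hs0).trans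
    (mul_le_mul_of_nonneg_left (by linarith [hs.1]) hR)

lemma tendsto_truncatedLaplace {u : ℝ → H} (hu : LocallyIntegrable u) {T : ℝ}
    (hT : 0 ≤ T) : Tendsto (fun x : ℝ => truncatedLaplace u T x) atBot (𝓝 0) := by
  have hi' : IntervalIntegrable u volume 0 T := intervalIntegrable_of_locallyIntegrable hu _ _
  have h0 : (0 : H) = ∫ s in (0 : ℝ)..T, (0 : H) := by simp
  rw [h0]
  refine intervalIntegral.tendsto_integral_filter_of_dominated_convergence (fun s => ‖u s‖)
    (Eventually.of_forall fun x => ?_) ?_ hi'.norm ?_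
  · exact (Continuous.aestronglyMeasurable (by fun_prop)).smul
      (by rw [Set.uIoc_of_le hT]; exact hi'.1.1)
  · filter_upwards [eventually_le_atBot 0] with x hx
    refine ae_of_all _ fun s hs => ?_
    rw [Set.uIoc_of_le hT] at hs
    rw [norm_smul, norm_cexp_mul_sub, Complex.ofReal_re]
    have : Real.exp (x * (T - s)) ≤ 1 :=
      Real.exp_le_one_iff.2 (mul_nonpos_of_nonpos_of_nonneg hx (by linarith [hs.2]))
    exact mul_le_of_le_one_left (norm_nonneg _) this
  · have hne : ∀ᵐ s ∂(volume : Measure ℝ), s ≠ T := by simp [ae_iff]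
    filter_upwards [hne] with s hsT hs
    rw [Set.uIoc_of_le hT] at hs
    have hs0 : 0 < T - s := sub_pos.2 (lt_of_le_of_ne hs.2 hsT)
    rw [tendsto_zero_iff_norm_tendsto_zero]
    simp only [norm_smul, norm_cexp_mul_sub, Complex.ofReal_re]
    rw [← zero_mul ‖u s‖]
    exact (Real.tendsto_exp_atBot.comp (tendsto_id.atBot_mul_const hs0)).mul_const _

variable [CompleteSpace H]

/-- If `M₀ u + ∫_0^t M₁ u = 0` on `(0, T)`, integration by parts turns the equation into
`ℳ(z) F(z) = ∫_0^T M₁ u` for the truncated Laplace transform `F`. -/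
lemma pencil_truncatedLaplace {u : ℝ → H} (hu : LocallyIntegrable u)
    (h : SolvesIntegrated M₀ M₁ 0 u) {T : ℝ} (hT : 0 ≤ T) (z : ℂ) :
    pencil M₀ M₁ z (truncatedLaplace u T z) = ∫ s in (0 : ℝ)..T, M₁ (u s) := by
  have hi' : IntervalIntegrable u volume 0 T := intervalIntegrable_of_locallyIntegrable hu _ _
  have hM₁ : IntervalIntegrable (fun s => M₁ (u s)) volume 0 T :=
    ⟨M₁.integrable_comp hi'.1, M₁.integrable_comp hi'.2⟩
  have hφ : ∀ t : ℝ, HasDerivAt (fun t : ℝ => Complex.exp (z * (T - t)))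
      (Complex.exp (z * (T - t)) * (z * -1)) t := fun t =>
    HasDerivAt.cexp (((Complex.ofRealCLM.hasDerivAt (x := t)).const_sub (T : ℂ)).const_mul z)
  have hcont : Continuous fun t : ℝ => Complex.exp (z * (T - t)) := by fun_prop
  have hp := integral_deriv_smul_primitive (g := fun s => M₁ (u s)) hT hφ (by fun_prop)
    ((intervalIntegrable_iff_integrableOn_Ioc_of_le hT).1 hM₁)
  have h1 : ∫ t in (0 : ℝ)..T,
      (Complex.exp (z * (T - t)) * (z * -1)) • ∫ s in (0 : ℝ)..t, M₁ (u s) =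
      ∫ t in (0 : ℝ)..T, z • M₀ (Complex.exp (z * (T - t)) • u t) := by
    refine intervalIntegral.integral_congr_ae ?_
    filter_upwards [h] with t ht hmem
    rw [Set.uIoc_of_le hT] at hmem
    have h2 := ht hmem.1
    rw [map_zero, add_eq_zero_iff_neg_eq] at h2
    rw [← h2, map_smul, smul_smul, smul_neg, ← neg_smul]
    congr 1
    ring
  have hF : IntervalIntegrable (fun t : ℝ => Complex.exp (z * (T - t)) • u t) volume 0 T :=
    hi'.continuousOn_smul hcont.continuousOn
  rw [h1, intervalIntegral.integral_smul, M₀.intervalIntegral_comp_comm hF] at hp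
  have h2 : ∫ t in (0 : ℝ)..T, Complex.exp (z * (T - t)) • M₁ (u t) =
      M₁ (truncatedLaplace u T z) := by
    rw [truncatedLaplace, ← M₁.intervalIntegral_comp_comm hF]
    simp only [map_smul]
  rw [h2] at hp
  simp only [sub_self, mul_zero, Complex.exp_zero, one_smul] at hp
  rw [pencil, add_apply, smul_apply]
  exact eq_sub_iff_add_eq.1 hp

/-- The truncated Laplace transform of a solution with initial value `0` is entire. It is bounded
on every left half-plane, and equal to `ℳ(z)⁻¹ ∫_0^T M₁ u`, hence bounded, on a right half-plane.
By Liouville's theorem it is constant, and its limit at `-∞` is `0`. -/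
lemma truncatedLaplace_eq_zero (hM : IsRegularPencil M₀ M₁) {u : ℝ → H}
    (hu : LocallyIntegrable u) (h : SolvesIntegrated M₀ M₁ 0 u) {T : ℝ} (hT : 0 ≤ T) (z : ℂ) :
    truncatedLaplace u T z = 0 := by
  obtain ⟨ν, hν⟩ := hM
  obtain ⟨C, hC⟩ := hν.2
  have hb : Bornology.IsBounded (Set.range (truncatedLaplace u T)) := by
    refine isBounded_iff_forall_norm_le.2
      ⟨max (Real.exp (|ν| * T) * ∫ s in (0 : ℝ)..T, ‖u s‖)
        (C * ‖∫ s in (0 : ℝ)..T, M₁ (u s)‖), ?_⟩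
    rintro _ ⟨w, rfl⟩
    rcases le_or_gt w.re ν with hw | hw
    · exact le_max_of_le_left
        (norm_truncatedLaplace_le hu hT (abs_nonneg ν) (hw.trans (le_abs_self ν)))
    · refine le_max_of_le_right ?_
      rw [← hν.pencilInv_pencil hw (truncatedLaplace u T w), pencil_truncatedLaplace hu h hT]
      exact (ContinuousLinearMap.le_opNorm _ _).trans
        (mul_le_mul_of_nonneg_right (hC w hw) (norm_nonneg _))
  have hconst : ∀ x : ℝ, truncatedLaplace u T x = truncatedLaplace u T z := fun x =>
    (differentiable_truncatedLaplace hu hT).apply_eq_apply_of_bounded hb _ _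
  have hlim := tendsto_truncatedLaplace hu hT
  simp only [hconst] at hlim
  exact tendsto_nhds_unique tendsto_const_nhds hlim

lemma ae_eq_zero_of_solvesIntegrated (hM : IsRegularPencil M₀ M₁) {u : ℝ → H}
    (hu : LocallyIntegrable u) (h : SolvesIntegrated M₀ M₁ 0 u) :
    ∀ᵐ t ∂(volume : Measure ℝ), 0 < t → u t = 0 := by
  have h0 : ∀ T : ℝ, 0 ≤ T → ∫ s in (0 : ℝ)..T, u s = 0 := fun T hT => by
    simpa [truncatedLaplace] using truncatedLaplace_eq_zero hM hu h hT 0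
  refine isOpen_Ioi.ae_eq_zero_of_integral_contDiff_smul_eq_zero (U := Set.Ioi (0 : ℝ))
    (hu.locallyIntegrableOn _) fun φ hφ hφc hφs => ?_
  obtain ⟨l, r, hl, hlr, hs⟩ := exists_Icc_of_tsupport_subset_Ioi hφc hφs
  have hr : 0 ≤ r := hl.le.trans hlr
  have hd : ∀ t, HasDerivAt φ (deriv φ t) t := fun t =>
    ((hφ.differentiable (by simp)) t).hasDerivAt
  have hp := integral_deriv_smul_primitive (g := u) hr hd (hφ.continuous_deriv (by simp))
    ((hu.integrableOn_isCompact isCompact_Icc).mono_set Set.Ioc_subset_Icc_self)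
  have h1 : ∫ t in (0 : ℝ)..r, deriv φ t • ∫ s in (0 : ℝ)..t, u s = 0 := by
    refine intervalIntegral.integral_zero_ae (ae_of_all _ fun t ht => ?_)
    rw [Set.uIoc_of_le hr] at ht
    rw [h0 t ht.1.le, smul_zero]
  rw [h1, h0 r hr, smul_zero, zero_sub, eq_comm, neg_eq_zero,
    intervalIntegral.integral_of_le hr, setIntegral_eq_integral_of_forall_compl_eq_zero] at hp
  · exact hp
  · intro t ht
    rw [image_eq_zero_of_notMem_tsupport fun h => ht ⟨hl.trans_le (hs h).1, (hs h).2⟩, zero_smul]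

end Uniqueness

/-! ### The distributional and the integrated equation -/

section Equations

variable {H : Type*} [NormedAddCommGroup H] [InnerProductSpace ℂ H]

/-- The inner product as a real bilinear map, with the arguments exchanged. -/
noncomputable def innerFlip (H : Type*) [NormedAddCommGroup H] [InnerProductSpace ℂ H] :
    H →L[ℝ] H →L[ℝ] ℂ :=
  (isBoundedBilinearMap_inner (𝕜 := ℂ) (E := H)).toContinuousLinearMap.flip

lemma innerFlip_apply (x y : H) : innerFlip H x y = inner ℂ y x := rfl

lemma locallyIntegrable_comp {E F : Type*} [NormedAddCommGroup E] [NormedSpace ℂ E]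
    [NormedAddCommGroup F] [NormedSpace ℂ F] (L : E →L[ℂ] F) {u : ℝ → E}
    (hu : LocallyIntegrable u) : LocallyIntegrable fun t => L (u t) := by
  intro x
  obtain ⟨s, hs, h⟩ := hu x
  exact ⟨s, hs, L.integrable_comp h⟩

lemma tendsto_average_of_continuous {k : ℝ → ℝ} (hk : Continuous k) :
    Tendsto (fun t : ℝ => (1 / t) * ∫ s in (0 : ℝ)..t, k s) (𝓝[>] 0) (𝓝 (k 0)) := by
  have h := (intervalIntegral.integral_hasDerivAt_right (hk.intervalIntegrable 0 0)
    (hk.stronglyMeasurableAtFilter _ _) hk.continuousAt).tendsto_slope_zero_right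
  simpa [one_div] using h

variable {M₀ M₁ : H →L[ℂ] H} {u₀ : H} {u : ℝ → H}

/-- If `M₀ u + ∫_0^t M₁ u = c`, the averages in the initial condition tend to `‖c - M₀ u₀‖`. -/
lemma tendsto_average_norm (hu : LocallyIntegrable u) {c : H}
    (h : ∀ᵐ t ∂(volume : Measure ℝ), 0 < t → M₀ (u t) + ∫ s in (0 : ℝ)..t, M₁ (u s) = c) :
    Tendsto (fun t : ℝ => (1 / t) * ∫ s in (0 : ℝ)..t, ‖M₀ (u s - u₀)‖) (𝓝[>] 0)
      (𝓝 ‖c - M₀ u₀‖) := by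
  have hV : Continuous fun t => ∫ s in (0 : ℝ)..t, M₁ (u s) :=
    intervalIntegral.continuous_primitive
      (intervalIntegrable_of_locallyIntegrable (locallyIntegrable_comp M₁ hu)) _
  have hk := tendsto_average_of_continuous
    (k := fun t => ‖c - M₀ u₀ - ∫ s in (0 : ℝ)..t, M₁ (u s)‖) (continuous_const.sub hV).norm
  simp only [intervalIntegral.integral_same, sub_zero] at hk
  refine hk.congr' ?_
  filter_upwards [self_mem_nhdsWithin] with t ht
  congr 1
  refine intervalIntegral.integral_congr_ae ?_
  filter_upwards [h] with s hs hmem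
  rw [Set.uIoc_of_le (le_of_lt ht)] at hmem
  rw [← hs hmem.1, map_sub]
  congr 1
  abel

lemma SolvesIntegrated.tendsto (hu : LocallyIntegrable u) (h : SolvesIntegrated M₀ M₁ u₀ u) :
    Tendsto (fun t => M₀ (u t)) (𝓝[>] (0 : ℝ) ⊓ ae volume) (𝓝 (M₀ u₀)) := by
  have hV : Continuous fun t => M₀ u₀ - ∫ s in (0 : ℝ)..t, M₁ (u s) :=
    continuous_const.sub (intervalIntegral.continuous_primitive
      (intervalIntegrable_of_locallyIntegrable (locallyIntegrable_comp M₁ hu)) _)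
  have h1 := hV.tendsto 0
  simp only [intervalIntegral.integral_same, sub_zero] at h1
  refine (h1.mono_left (inf_le_left.trans nhdsWithin_le_nhds)).congr' ?_
  filter_upwards [mem_inf_of_left self_mem_nhdsWithin, mem_inf_of_right h] with t ht h2
  rw [← h2 ht, add_sub_cancel_right]

variable [CompleteSpace H]

lemma SolvesDistributionally.exists_const (hu : LocallyIntegrable u)
    (h : SolvesDistributionally M₀ M₁ u) :
    ∃ c : H, ∀ᵐ t ∂(volume : Measure ℝ), 0 < t → M₀ (u t) + ∫ s in (0 : ℝ)..t, M₁ (u s) = c := by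
  refine exists_ae_add_primitive_eq_const (locallyIntegrable_comp M₀ hu)
    (locallyIntegrable_comp M₁ hu) fun ψ hψ hc hs => ?_
  have hψ' : Continuous (deriv ψ) := hψ.continuous_deriv (by simp)
  have hz : ∀ t, t ∉ Set.Ioi (0 : ℝ) → ψ t = 0 ∧ deriv ψ t = 0 := fun t ht =>
    ⟨image_eq_zero_of_notMem_tsupport fun h => ht (hs h),
      image_eq_zero_of_notMem_tsupport fun h => ht (hs (tsupport_deriv_subset h))⟩
  have hi₀ := integrable_smul_of_hasCompactSupport hψ' hc.deriv (locallyIntegrable_comp M₀ hu)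
  have hi₁ := integrable_smul_of_hasCompactSupport hψ.continuous hc (locallyIntegrable_comp M₁ hu)
  -- Test functions of the form `ψ • x` suffice.
  refine ext_inner_right ℂ fun x => ?_
  have hx := h (fun t => ψ t • x) (hψ.smul contDiff_const) hc.smul_right
    ((tsupport_smul_subset_left _ _).trans hs)
  have hd : ∀ t, deriv (fun t => ψ t • x) t = deriv ψ t • x := fun t =>
    ((hψ.differentiable (by simp)) t).hasDerivAt.smul_const x |>.deriv
  have e : ∀ (χ : ℝ → ℝ) (v : ℝ → H), (∀ t, t ∉ Set.Ioi (0 : ℝ) → χ t = 0) →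
      Integrable (fun t => χ t • v t) →
      ∫ t in Set.Ioi (0 : ℝ), inner ℂ (v t) (χ t • x) = inner ℂ (∫ t, χ t • v t) x := by
    intro χ v hχ hi
    rw [← innerFlip_apply, ← (innerFlip H x).integral_comp_comm hi,
      setIntegral_eq_integral_of_forall_compl_eq_zero]
    · refine integral_congr_ae (ae_of_all _ fun t => ?_)
      simp only [innerFlip_apply, ← Complex.coe_smul, inner_smul_left, inner_smul_right,
        Complex.conj_ofReal]
    · intro t ht
      rw [hχ t ht, zero_smul, inner_zero_right]
  simp only [hd] at hx
  rw [e _ _ (fun t ht => (hz t ht).2) hi₀, e _ _ (fun t ht => (hz t ht).1) hi₁] at hx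
  linear_combination -hx

lemma SolvesIntegrated.solvesDistributionally (hu : LocallyIntegrable u)
    (h : SolvesIntegrated M₀ M₁ u₀ u) : SolvesDistributionally M₀ M₁ u := by
  intro φ hφ hc hs
  obtain ⟨l, r, hl, hlr, hlr'⟩ := exists_Icc_of_tsupport_subset_Ioi hc hs
  have hr : (0 : ℝ) ≤ r + 1 := by linarith
  have hz : ∀ t, t ∉ Set.Icc l r → φ t = 0 ∧ deriv φ t = 0 := fun t ht =>
    ⟨image_eq_zero_of_notMem_tsupport fun h => ht (hlr' h),
      image_eq_zero_of_notMem_tsupport fun h => ht (hlr' (tsupport_deriv_subset h))⟩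
  -- The upper limit is `r + 1` because the support of `φ` may reach `r`.
  have hI : ∀ f : ℝ → ℂ, (∀ t, t ∉ Set.Icc l r → f t = 0) →
      ∫ t in Set.Ioi (0 : ℝ), f t = ∫ t in (0 : ℝ)..(r + 1), f t := by
    intro f hf
    rw [intervalIntegral.integral_of_le hr, setIntegral_eq_integral_of_forall_compl_eq_zero,
      setIntegral_eq_integral_of_forall_compl_eq_zero]
    · exact fun t ht => hf t fun h => ht ⟨hl.trans_le h.1, by linarith [h.2]⟩
    · exact fun t ht => hf t fun h => ht (hl.trans_le h.1)
  have hφ' : Continuous (deriv φ) := hφ.continuous_deriv (by simp)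
  have hM₁ := locallyIntegrable_comp M₁ hu
  have hd : ∀ t, HasDerivAt φ (deriv φ t) t := fun t =>
    ((hφ.differentiable (by simp)) t).hasDerivAt
  have hp := integral_deriv_bilin_primitive (innerFlip H) (g := fun t => M₁ (u t)) hr hd hφ'
    ((intervalIntegrable_iff_integrableOn_Ioc_of_le hr).1
      (intervalIntegrable_of_locallyIntegrable hM₁ _ _))
  have h0 : φ 0 = 0 := (hz 0 fun h => absurd h.1 (not_le.2 hl)).1
  have hr0 : φ (r + 1) = 0 := (hz (r + 1) fun h => by linarith [h.2]).1
  have h1 : ∫ t in (0 : ℝ)..(r + 1), inner ℂ (M₀ (u t)) (deriv φ t) =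
      ∫ t in (0 : ℝ)..(r + 1), (inner ℂ (M₀ u₀) (deriv φ t) -
        innerFlip H (deriv φ t) (∫ s in (0 : ℝ)..t, M₁ (u s))) := by
    refine intervalIntegral.integral_congr_ae ?_
    filter_upwards [h] with t ht hmem
    rw [Set.uIoc_of_le hr] at hmem
    rw [innerFlip_apply, ← inner_sub_left, ← ht hmem.1, add_sub_cancel_right]
  have hV : Continuous fun t => ∫ s in (0 : ℝ)..t, M₁ (u s) :=
    intervalIntegral.continuous_primitive (intervalIntegrable_of_locallyIntegrable hM₁) _
  rw [hI _ fun t ht => by rw [(hz t ht).2, inner_zero_right],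
    hI _ fun t ht => by rw [(hz t ht).1, inner_zero_right], h1,
    intervalIntegral.integral_sub
      ((continuous_const.inner hφ').intervalIntegrable _ _)
      ((hV.inner hφ').intervalIntegrable _ _), hp, hr0, map_zero]
  have h2 : ∫ t in (0 : ℝ)..(r + 1), inner ℂ (M₀ u₀) (deriv φ t) = (0 : ℂ) := by
    rw [intervalIntegral.integral_eq_sub_of_hasDerivAt (f := fun t => inner ℂ (M₀ u₀) (φ t))
      (f' := fun t => inner ℂ (M₀ u₀) (deriv φ t))
      (fun t _ => HasFDerivAt.comp_hasDerivAt_of_eq (f' := deriv φ t) t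
        ((innerFlip H).flip (M₀ u₀)).hasFDerivAt (hd t) rfl)
      ((continuous_const.inner hφ').intervalIntegrable _ _), h0, hr0]
    simp
  rw [h2]
  simp [innerFlip_apply]

lemma solvesIntegrated_iff (hu : LocallyIntegrable u) :
    SolvesIntegrated M₀ M₁ u₀ u ↔
      SolvesDistributionally M₀ M₁ u ∧ AttainsInitialValue M₀ u₀ u := by
  constructor
  · intro h
    refine ⟨h.solvesDistributionally hu, ?_⟩
    simpa [AttainsInitialValue] using tendsto_average_norm (u₀ := u₀) hu h
  · rintro ⟨h, h'⟩
    obtain ⟨c, hc⟩ := h.exists_const hu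
    have := tendsto_nhds_unique (tendsto_average_norm (u₀ := u₀) hu hc) h'
    rw [norm_eq_zero, sub_eq_zero] at this
    subst this
    exact hc

/-- Two mild solutions with the same initial value agree almost everywhere. -/
lemma ae_eq_of_solvesIntegrated (hM : IsRegularPencil M₀ M₁) {v : ℝ → H}
    (hu : LocallyIntegrable u) (hv : LocallyIntegrable v) (hu0 : essSupport u ⊆ Set.Ici 0)
    (hv0 : essSupport v ⊆ Set.Ici 0) (h : SolvesIntegrated M₀ M₁ u₀ u)
    (h' : SolvesIntegrated M₀ M₁ u₀ v) : v =ᵐ[volume] u := by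
  have hI := fun t => intervalIntegrable_of_locallyIntegrable (locallyIntegrable_comp M₁ hu) 0 t
  have hJ := fun t => intervalIntegrable_of_locallyIntegrable (locallyIntegrable_comp M₁ hv) 0 t
  have hd : SolvesIntegrated M₀ M₁ 0 (fun t => v t - u t) := by
    filter_upwards [h, h'] with t ht ht' h0
    simp only [map_sub, map_zero]
    rw [intervalIntegral.integral_sub (hJ t) (hI t), sub_add_sub_comm, ht h0, ht' h0, sub_self]
  have hne : ∀ᵐ t ∂(volume : Measure ℝ), t ≠ 0 := by simp [ae_iff]
  filter_upwards [ae_eq_zero_of_solvesIntegrated hM (hv.sub hu) hd,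
    essSupport_subset_Ici_iff.1 hu0, essSupport_subset_Ici_iff.1 hv0, hne] with t h1 h2 h3 h4
  rcases lt_or_gt_of_ne h4 with h5 | h5
  · rw [h2 h5, h3 h5]
  · exact sub_eq_zero.1 (h1 h5)

end Equations

/-! ### Transforms of test functions -/

section TestFunctions

/-- The transform `z ↦ ∫ exp (zs) φ(s) ds`, transposed to the Laplace transform. -/
noncomputable def testTransform (φ : ℝ → ℝ) (z : ℂ) : ℂ := ∫ s : ℝ, Complex.exp (z * s) * φ s

variable {φ : ℝ → ℝ}

lemma integrable_exp_mul (hφ : Continuous φ) (hc : HasCompactSupport φ) (z : ℂ) :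
    Integrable fun s : ℝ => Complex.exp (z * s) * φ s := by
  refine Continuous.integrable_of_hasCompactSupport (by fun_prop) ?_
  exact HasCompactSupport.mul_left (hc.comp_left (g := fun x : ℝ => (x : ℂ)) Complex.ofReal_zero)

lemma testTransform_deriv (hφ : ContDiff ℝ ∞ φ) (hc : HasCompactSupport φ) (z : ℂ) :
    testTransform (deriv φ) z = -z * testTransform φ z := by
  have hφ' : Continuous (deriv φ) := hφ.continuous_deriv (by simp)
  have h := integral_mul_deriv_eq_deriv_mul_of_integrable
    (u := fun s : ℝ => Complex.exp (z * s)) (v := fun s : ℝ => (φ s : ℂ))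
    (u' := fun s : ℝ => Complex.exp (z * s) * z) (v' := fun s : ℝ => ((deriv φ s : ℝ) : ℂ))
    (fun s _ => by
      have h1 : HasDerivAt (fun s : ℝ => z * (s : ℂ)) z s := by
        simpa using (Complex.ofRealCLM.hasDerivAt (x := s)).const_mul z
      exact h1.cexp)
    (fun s _ => (((hφ.differentiable (by simp)) s).hasDerivAt).ofReal_comp)
    (integrable_exp_mul hφ' hc.deriv z)
    ((integrable_exp_mul hφ.continuous hc z).const_mul z |>.congr
      (ae_of_all _ fun s => by simp only [Pi.mul_apply]; ring))
    (integrable_exp_mul hφ.continuous hc z)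
  rw [testTransform, h, testTransform, neg_mul, ← integral_const_mul]
  congr 2
  funext s
  ring

lemma differentiable_testTransform (hφ : Continuous φ) (hc : HasCompactSupport φ) :
    Differentiable ℂ (testTransform φ) := by
  intro z
  have hcφ := hc.comp_left (g := fun x : ℝ => ‖x‖) norm_zero
  refine (hasDerivAt_integral_of_dominated_loc_of_deriv_le
    (F := fun (w : ℂ) (s : ℝ) => Complex.exp (w * s) * φ s)
    (F' := fun (w : ℂ) (s : ℝ) => Complex.exp (w * s) * s * φ s)
    (bound := fun s => Real.exp ((‖z‖ + 1) * |s|) * |s| * ‖φ s‖)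
    (Metric.ball_mem_nhds z one_pos) (Eventually.of_forall fun w => ?_)
    (integrable_exp_mul hφ hc z) ?_ ?_ ?_ ?_).2.differentiableAt
  · exact (integrable_exp_mul hφ hc w).1
  · exact Continuous.aestronglyMeasurable (by fun_prop)
  · refine ae_of_all _ fun s w hw => ?_
    rw [norm_mul, norm_mul, Complex.norm_real, Complex.norm_real, Complex.norm_exp,
      Real.norm_eq_abs s]
    have hw1 : ‖w‖ ≤ ‖z‖ + 1 := by
      have h2 := norm_le_norm_add_norm_sub' w z
      rw [mem_ball_iff_norm] at hw
      linarith
    have h3 : (w * s).re ≤ (‖z‖ + 1) * |s| := by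
      refine (Complex.re_le_norm _).trans ?_
      rw [norm_mul, Complex.norm_real, Real.norm_eq_abs]
      gcongr
    gcongr
  · exact Continuous.integrable_of_hasCompactSupport (by fun_prop) (hcφ.mul_left)
  · refine ae_of_all _ fun s w _ => ?_
    have h : HasDerivAt (fun w : ℂ => w * (s : ℂ)) (s : ℂ) w := by
      simpa using (hasDerivAt_id w).mul_const (s : ℂ)
    exact h.cexp.mul_const _

lemma norm_testTransform_le (hφ : Continuous φ) (hc : HasCompactSupport φ) {c : ℝ} {z : ℂ}
    (hz : |z.re| ≤ c) : ‖testTransform φ z‖ ≤ ∫ s, Real.exp (c * |s|) * ‖φ s‖ := by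
  have hcφ := hc.comp_left (g := fun x : ℝ => ‖x‖) norm_zero
  refine norm_integral_le_of_norm_le
    (Continuous.integrable_of_hasCompactSupport (by fun_prop) hcφ.mul_left)
    (ae_of_all _ fun s => ?_)
  rw [norm_mul, Complex.norm_real, Complex.norm_exp, Complex.re_mul_ofReal]
  have h : z.re * s ≤ c * |s| :=
    (le_abs_self _).trans (by rw [abs_mul]; gcongr)
  gcongr

/-- Transforms of test functions decay quadratically on vertical strips. -/
lemma exists_norm_testTransform_le (hφ : ContDiff ℝ ∞ φ) (hc : HasCompactSupport φ) (c : ℝ) :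
    ∃ K, 0 ≤ K ∧ ∀ z : ℂ, |z.re| ≤ c → z ≠ 0 → ‖testTransform φ z‖ ≤ K / ‖z‖ ^ 2 := by
  have hφ' : ContDiff ℝ ∞ (deriv φ) := (contDiff_infty_iff_deriv.1 hφ).2
  refine ⟨∫ s, Real.exp (c * |s|) * ‖deriv (deriv φ) s‖, integral_nonneg fun s => by positivity,
    fun z hz h0 => ?_⟩
  have h := norm_testTransform_le (hφ'.continuous_deriv (by simp)) hc.deriv.deriv hz
  rw [testTransform_deriv hφ' hc.deriv, testTransform_deriv hφ hc, norm_mul, norm_mul,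
    norm_neg] at h
  rw [le_div_iff₀ (by positivity)]
  linarith

lemma integrable_const_div_sq {a : ℝ} (ha : 0 < a) (K : ℝ) :
    Integrable fun t : ℝ => K / ‖Complex.I * t + a‖ ^ 2 := by
  have hn : ∀ t : ℝ, ‖Complex.I * t + a‖ ^ 2 = a ^ 2 + t ^ 2 := fun t => by
    rw [← Complex.normSq_eq_norm_sq, Complex.normSq_apply]
    simp
    ring
  have h := ((integrable_inv_one_add_sq.comp_mul_left' (R := a⁻¹) (by positivity)).const_mul
    (K / a ^ 2))
  refine h.congr (ae_of_all _ fun t => ?_)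
  simp only [hn]
  field_simp

/-- Vertical integrals of a holomorphic function that decays quadratically do not depend on the
abscissa. -/
lemma integral_vertical_eq {E : Type*} [NormedAddCommGroup E] [NormedSpace ℂ E] [CompleteSpace E]
    {f : ℂ → E} {a b K : ℝ} (ha : 0 < a) (hab : a ≤ b)
    (hf : ∀ z : ℂ, a ≤ z.re → DifferentiableAt ℂ f z)
    (hK : ∀ z : ℂ, a ≤ z.re → z.re ≤ b → ‖f z‖ ≤ K / ‖z‖ ^ 2) :
    ∫ t : ℝ, f (Complex.I * t + a) = ∫ t : ℝ, f (Complex.I * t + b) := by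
  have hcont : ∀ x, a ≤ x → Continuous fun t : ℝ => f (Complex.I * t + x) := fun x hx =>
    continuous_iff_continuousAt.2 fun t =>
      ContinuousAt.comp (f := fun t : ℝ => Complex.I * (t : ℂ) + x)
        (hf _ (by simpa using hx)).continuousAt (by fun_prop)
  have hint : ∀ x, a ≤ x → x ≤ b → Integrable fun t : ℝ => f (Complex.I * t + x) :=
    fun x hx hx' => (integrable_const_div_sq (ha.trans_le hx) K).mono'
      (hcont x hx).aestronglyMeasurable
      (ae_of_all _ fun t => hK _ (by simpa using hx) (by simpa using hx'))
  have hlim : ∀ x, a ≤ x → x ≤ b → Tendsto (fun T : ℝ => ∫ t in (-T)..T, f (Complex.I * t + x))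
      atTop (𝓝 (∫ t : ℝ, f (Complex.I * t + x))) := fun x hx hx' =>
    intervalIntegral_tendsto_integral (hint x hx hx') tendsto_neg_atTop_atBot tendsto_id
  -- The horizontal edges of the rectangle at height `±T`.
  have hedge : ∀ σ : ℝ, |σ| = 1 →
      Tendsto (fun T : ℝ => ∫ x in a..b, f (x + (σ * T : ℝ) * Complex.I)) atTop (𝓝 0) := by
    intro σ hσ
    refine squeeze_zero_norm' (a := fun T : ℝ => |K| / T ^ 2 * |b - a|) ?_ ?_
    · filter_upwards [eventually_gt_atTop 0] with T hT
      refine intervalIntegral.norm_integral_le_of_norm_le_const fun x hx => ?_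
      rw [Set.uIoc_of_le hab] at hx
      refine (hK _ (by simpa using hx.1.le) (by simpa using hx.2)).trans ?_
      have h1 : T ≤ ‖(x : ℂ) + (σ * T : ℝ) * Complex.I‖ := by
        have := Complex.abs_im_le_norm ((x : ℂ) + (σ * T : ℝ) * Complex.I)
        simpa [abs_mul, hσ, abs_of_pos hT] using this
      gcongr
      exact le_abs_self K
    · have h2 : Tendsto (fun T : ℝ => |K| / T ^ 2) atTop (𝓝 0) :=
        Tendsto.div_atTop tendsto_const_nhds (tendsto_pow_atTop two_ne_zero)
      simpa using h2.mul_const |b - a|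
  have hrect : ∀ T : ℝ, (∫ x in a..b, f (x + ((-1) * T : ℝ) * Complex.I))
      - (∫ x in a..b, f (x + (1 * T : ℝ) * Complex.I))
      + Complex.I • (∫ t in (-T)..T, f (Complex.I * t + b))
      - Complex.I • (∫ t in (-T)..T, f (Complex.I * t + a)) = 0 := by
    intro T
    have h := Complex.integral_boundary_rect_eq_zero_of_differentiableOn f
      (⟨a, -T⟩ : ℂ) (⟨b, T⟩ : ℂ) (fun z hz => by
        have h1 := hz.1
        simp only [Set.mem_preimage, Set.uIcc_of_le hab] at h1
        exact (hf z h1.1).differentiableWithinAt)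
    have hcomm : ∀ (x t : ℝ), (x : ℂ) + t * Complex.I = Complex.I * t + x := fun x t => by ring
    simp only [hcomm] at h ⊢
    simpa using h
  have h1 := (((hedge (-1) (by simp)).sub (hedge 1 (by simp))).add
    ((hlim b hab le_rfl).const_smul Complex.I)).sub ((hlim a le_rfl hab).const_smul Complex.I)
  simp only [hrect] at h1
  have h2 := tendsto_nhds_unique tendsto_const_nhds h1
  rw [sub_zero, zero_add, ← smul_sub, eq_comm, smul_eq_zero] at h2
  exact (sub_eq_zero.1 (h2.resolve_left Complex.I_ne_zero)).symm

end TestFunctions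

/-! ### Parseval's identity for the Fourier–Laplace transform -/

section Parseval

open scoped FourierTransform SchwartzMap

variable {φ : ℝ → ℝ}

lemma exists_schwartzMap_exp_mul (hφ : ContDiff ℝ ∞ φ) (hc : HasCompactSupport φ) (ρ : ℝ) :
    ∃ θ : 𝓢(ℝ, ℂ), (∀ s, θ s = Real.exp (ρ * s) * φ s) ∧
      ∀ ξ : ℝ, 𝓕⁻ θ ξ = testTransform φ (Complex.I * (2 * Real.pi * ξ : ℝ) + ρ) := by
  have hθ : ContDiff ℝ ∞ fun s : ℝ => (Real.exp (ρ * s) : ℂ) * φ s := by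
    have h1 : ContDiff ℝ ∞ fun s : ℝ => ((Real.exp (ρ * s) * φ s : ℝ) : ℂ) :=
      Complex.ofRealCLM.contDiff.comp
        ((Real.contDiff_exp.comp (contDiff_const.mul contDiff_id)).mul hφ)
    simpa using h1
  have hθc : HasCompactSupport fun s : ℝ => (Real.exp (ρ * s) : ℂ) * φ s :=
    HasCompactSupport.mul_left (hc.comp_left (g := fun x : ℝ => (x : ℂ)) Complex.ofReal_zero)
  refine ⟨hθc.toSchwartzMap hθ, fun s => by simp, fun ξ => ?_⟩
  rw [SchwartzMap.fourierInv_coe, Real.fourierInv_eq', testTransform]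
  congr 1
  funext s
  simp only [HasCompactSupport.toSchwartzMap_toFun, smul_eq_mul]
  rw [← mul_assoc, Complex.ofReal_exp, ← Complex.exp_add]
  congr 2
  simp only [RCLike.inner_apply, conj_trivial]
  push_cast
  ring

/-- Fourier inversion at the origin. -/
lemma integral_testTransform (hφ : ContDiff ℝ ∞ φ) (hc : HasCompactSupport φ) (ρ : ℝ) :
    ∫ t : ℝ, testTransform φ (Complex.I * t + ρ) = 2 * Real.pi * φ 0 := by
  obtain ⟨θ, hθ, hθ'⟩ := exists_schwartzMap_exp_mul hφ hc ρ
  have h1 : 𝓕 (𝓕⁻ θ) 0 = θ 0 := by rw [FourierTransform.fourier_fourierInv_eq]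
  rw [SchwartzMap.fourier_coe, Real.fourier_eq', hθ] at h1
  simp only [hθ', inner_zero_right, mul_zero, Complex.ofReal_zero, zero_mul,
    Complex.exp_zero, one_smul, Real.exp_zero, Complex.ofReal_one, one_mul] at h1
  rw [Measure.integral_comp_mul_left
    (fun t : ℝ => testTransform φ (Complex.I * t + ρ)) (2 * Real.pi),
    abs_of_pos (by positivity), Complex.real_smul] at h1
  have hp : (2 * Real.pi : ℂ) ≠ 0 := by
    exact_mod_cast (by positivity : (2 * Real.pi : ℝ) ≠ 0)
  rw [← h1]
  push_cast
  field_simp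

variable {H : Type*} [NormedAddCommGroup H] [InnerProductSpace ℂ H] [CompleteSpace H]

/-- Parseval's identity in transposed form: pairing with a test function determines
`u ∈ L_{2,ρ}` from its Fourier–Laplace transform. -/
lemma integral_smul_eq_of_fourierLaplace (hφ : ContDiff ℝ ∞ φ) (hc : HasCompactSupport φ) {ρ : ℝ}
    {u h : ℝ → H} (hu : MemLp u 2 (expMeasure ρ)) (huh : fourierLaplace H ρ hu.toLp =ᵐ[volume] h) :
    ∫ t, φ t • u t =
      ((√(2 * Real.pi))⁻¹ : ℂ) • ∫ t : ℝ, testTransform φ (Complex.I * t + ρ) • h t := by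
  obtain ⟨θ, hθ, hθ'⟩ := exists_schwartzMap_exp_mul hφ hc ρ
  set v : Lp H 2 (volume : Measure ℝ) := expMul H ρ hu.toLp with hv
  have hvu : v =ᵐ[volume] fun t => (Real.exp (-ρ * t) : ℂ) • u t := by
    have h1 : v = (memLp_exp_smul ρ u hu).toLp := lpIsometryEquiv_toLp _ _ _ _ _ _ _ hu
    rw [h1]
    exact MemLp.coeFn_toLp _
  set F : Lp H 2 (volume : Measure ℝ) := Lp.fourierTransformₗᵢ ℝ H v with hF
  have hFh : (fun t : ℝ => F ((2 * Real.pi)⁻¹ * t)) =ᵐ[volume]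
      fun t => (√(2 * Real.pi) : ℂ) • h t := by
    have h1 : fourierLaplace H ρ hu.toLp =ᵐ[volume]
        fun t => (√((2 * Real.pi)⁻¹) : ℂ) • F ((2 * Real.pi)⁻¹ * t) :=
      MemLp.coeFn_toLp (memLp_dilation inv_two_pi_pos F (Lp.memLp F))
    filter_upwards [h1, huh] with t h2 h3
    rw [← h3, h2, smul_smul, ← Complex.ofReal_mul, ← Real.sqrt_mul (by positivity),
      mul_inv_cancel₀ (by positivity)]
    simp
  have hpars : ∫ ξ, 𝓕⁻ θ ξ • F ξ = ∫ t, θ t • v t := by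
    have h1 := DFunLike.congr_fun (Lp.fourier_toTemperedDistribution_eq v) (𝓕⁻ θ)
    rw [TemperedDistribution.fourier_apply, Lp.toTemperedDistribution_apply,
      Lp.toTemperedDistribution_apply, FourierTransform.fourier_fourierInv_eq] at h1
    exact h1.symm
  have h1 : ∫ t, θ t • v t = ∫ t, φ t • u t := by
    refine integral_congr_ae ?_
    filter_upwards [hvu] with t ht
    rw [ht, hθ, smul_smul, mul_right_comm, ← Complex.ofReal_mul, ← Real.exp_add]
    simp
  have h2 : ∫ t : ℝ, testTransform φ (Complex.I * t + ρ) • F ((2 * Real.pi)⁻¹ * t) =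
      (2 * Real.pi) • ∫ ξ, 𝓕⁻ θ ξ • F ξ := by
    have h3 := Measure.integral_comp_mul_left (fun ξ => 𝓕⁻ θ ξ • F ξ) (2 * Real.pi)⁻¹
    rw [inv_inv, abs_of_pos (by positivity)] at h3
    rw [← h3]
    congr 1
    funext t
    rw [hθ', mul_inv_cancel_left₀ (by positivity)]
  rw [hpars, h1] at h2
  have h4 : ∫ t : ℝ, testTransform φ (Complex.I * t + ρ) • F ((2 * Real.pi)⁻¹ * t) =
      (√(2 * Real.pi) : ℂ) • ∫ t : ℝ, testTransform φ (Complex.I * t + ρ) • h t := by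
    rw [← integral_smul]
    refine integral_congr_ae ?_
    filter_upwards [hFh] with t ht
    rw [ht, smul_comm]
  rw [h4] at h2
  have hp : (0 : ℝ) < 2 * Real.pi := by positivity
  have hs : (√(2 * Real.pi) : ℂ) ≠ 0 := by exact_mod_cast (Real.sqrt_pos.2 hp).ne'
  have h5 : (2 * Real.pi) • ∫ t, φ t • u t =
      (√(2 * Real.pi) : ℂ) • (√(2 * Real.pi) : ℂ) • ∫ t, φ t • u t := by
    rw [smul_smul, ← Complex.ofReal_mul, Real.mul_self_sqrt hp.le, Complex.coe_smul]
  rw [h5] at h2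
  rw [smul_right_injective H hs h2, smul_smul, inv_mul_cancel₀ hs, one_smul]

end Parseval

/-! ### Existence -/

section Existence

variable {H : Type*} [NormedAddCommGroup H] [InnerProductSpace ℂ H]

lemma locallyIntegrable_of_memLp_expMeasure {ρ : ℝ} {u : ℝ → H} (hu : MemLp u 2 (expMeasure ρ)) :
    LocallyIntegrable u := by
  have h1 : LocallyIntegrable fun t => (Real.exp (-ρ * t) : ℂ) • u t :=
    (memLp_exp_smul ρ u hu).locallyIntegrable (by norm_num)
  have h2 : LocallyIntegrable fun t => (Real.exp (ρ * t) : ℂ) • (Real.exp (-ρ * t) : ℂ) • u t := by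
    rw [← locallyIntegrableOn_univ] at h1 ⊢
    exact h1.continuousOn_smul isOpen_univ.isLocallyClosed (by fun_prop)
  refine h2.congr (ae_of_all _ fun t => ?_)
  beta_reduce
  rw [smul_smul, ← Complex.ofReal_mul, ← Real.exp_add]
  simp

/-- If the norms of `u` in `L_{2,ρ}` stay bounded as `ρ → ∞`, then `u` vanishes on the negative
half-line. -/
lemma ae_eq_zero_of_eLpNorm_expMeasure_le {u : ℝ → H} {ρ₀ : ℝ} {B : ℝ≥0∞} (hB : B ≠ ⊤)
    (hm : AEStronglyMeasurable u volume)
    (h : ∀ ρ, ρ₀ ≤ ρ → eLpNorm u 2 (expMeasure ρ) ≤ B) :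
    ∀ᵐ t ∂(volume : Measure ℝ), t < 0 → u t = 0 := by
  have key : ∀ δ : ℝ, 0 < δ → ∀ᵐ t ∂(volume : Measure ℝ), t ∈ Set.Iio (-δ) → u t = 0 := by
    intro δ hδ
    -- On `t < -δ` the weight `exp (-ρt)` is at least `exp (δρ)`.
    have h1 : ∀ ρ, max ρ₀ 0 ≤ ρ → eLpNorm u 2 (volume.restrict (Set.Iio (-δ))) ≤
        ENNReal.ofReal (Real.exp (-δ * ρ)) * B := by
      intro ρ hρ
      refine le_trans ?_ (mul_le_mul_right (h ρ ((le_max_left _ _).trans hρ)) _)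
      rw [← eLpNorm_expMeasure]
      have h2 : eLpNorm (fun t => (Real.exp (-δ * ρ) : ℂ) • (Real.exp (-ρ * t) : ℂ) • u t) 2
          (volume.restrict (Set.Iio (-δ))) ≤ ENNReal.ofReal (Real.exp (-δ * ρ)) *
          eLpNorm (fun t => (Real.exp (-ρ * t) : ℂ) • u t) 2 volume := by
        refine (eLpNorm_restrict_le _ _ _ _).trans ?_
        refine (eLpNorm_const_smul_le (c := (Real.exp (-δ * ρ) : ℂ))).trans_eq ?_
        rw [← ofReal_norm, Complex.norm_real, Real.norm_of_nonneg (Real.exp_pos _).le]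
      refine le_trans (eLpNorm_mono_ae ?_) h2
      filter_upwards [ae_restrict_mem measurableSet_Iio] with t ht
      rw [smul_smul, norm_smul, ← Complex.ofReal_mul, ← Real.exp_add, Complex.norm_real,
        Real.norm_of_nonneg (Real.exp_pos _).le]
      refine le_mul_of_one_le_left (norm_nonneg _) (Real.one_le_exp ?_)
      have hρ0 : 0 ≤ ρ := (le_max_right _ _).trans hρ
      have ht' : t < -δ := ht
      nlinarith
    have h2 : Tendsto (fun ρ : ℝ => ENNReal.ofReal (Real.exp (-δ * ρ)) * B) atTop (𝓝 0) := by
      have h3 : Tendsto (fun ρ : ℝ => Real.exp (-δ * ρ)) atTop (𝓝 0) :=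
        Real.tendsto_exp_atBot.comp (tendsto_id.const_mul_atTop_of_neg (by linarith))
      have h4 := ENNReal.Tendsto.mul_const (ENNReal.tendsto_ofReal h3) (Or.inr hB)
      simpa using h4
    have h3 : eLpNorm u 2 (volume.restrict (Set.Iio (-δ))) = 0 :=
      le_antisymm (ge_of_tendsto h2 ((eventually_ge_atTop _).mono h1)) zero_le
    rw [eLpNorm_eq_zero_iff hm.restrict (by simp)] at h3
    exact (ae_restrict_iff' measurableSet_Iio).1 h3
  have hall : ∀ᵐ t ∂(volume : Measure ℝ), ∀ n : ℕ, t ∈ Set.Iio (-(1 / ((n : ℝ) + 1))) → u t = 0 :=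
    ae_all_iff.2 fun n => key _ (by positivity)
  filter_upwards [hall] with t ht hneg
  obtain ⟨n, hn⟩ := exists_nat_one_div_lt (neg_pos.2 hneg)
  exact ht n (by simp only [Set.mem_Iio]; linarith)

variable [CompleteSpace H] {M₀ M₁ : H →L[ℂ] H} {u₀ : H} {u v : ℝ → H} {ρ ν : ℝ}

lemma HasLaplaceRepresentation.congr (h : HasLaplaceRepresentation M₀ M₁ u₀ u ρ)
    (huv : u =ᵐ[volume] v) : HasLaplaceRepresentation M₀ M₁ u₀ v ρ := by
  obtain ⟨hu, h⟩ := h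
  have huv' := (expMeasure_ac_volume ρ).ae_le huv
  refine ⟨hu.ae_eq huv', ?_⟩
  rwa [← MemLp.toLp_congr hu _ huv']

lemma HasLaplaceRepresentation.ae_eq (hu : HasLaplaceRepresentation M₀ M₁ u₀ u ρ)
    (hv : HasLaplaceRepresentation M₀ M₁ u₀ v ρ) : u =ᵐ[volume] v := by
  obtain ⟨hu, hu'⟩ := hu
  obtain ⟨hv, hv'⟩ := hv
  have h : hu.toLp = hv.toLp := (fourierLaplace H ρ).injective (Lp.ext (hu'.trans hv'.symm))
  exact (volume_ac_expMeasure ρ).ae_le (MemLp.toLp_eq_toLp_iff _ _ |>.1 h)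

lemma HasLaplaceRepresentation.locallyIntegrable (h : HasLaplaceRepresentation M₀ M₁ u₀ u ρ) :
    LocallyIntegrable u := locallyIntegrable_of_memLp_expMeasure h.choose

lemma HasLaplaceRepresentation.integral_smul (h : HasLaplaceRepresentation M₀ M₁ u₀ u ρ)
    {φ : ℝ → ℝ} (hφ : ContDiff ℝ ∞ φ) (hc : HasCompactSupport φ) :
    ∫ t, φ t • u t = ((2 * Real.pi : ℂ))⁻¹ • ∫ t : ℝ, testTransform φ (Complex.I * t + ρ) •
      pencilInv M₀ M₁ (Complex.I * t + ρ) (M₀ u₀) := by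
  obtain ⟨hu, h⟩ := h
  rw [integral_smul_eq_of_fourierLaplace hφ hc hu h]
  simp only [smul_comm _ ((√(2 * Real.pi))⁻¹ : ℂ)]
  rw [MeasureTheory.integral_smul, smul_smul]
  congr 1
  rw [← mul_inv, ← Complex.ofReal_mul, Real.mul_self_sqrt (by positivity)]
  push_cast
  rfl

lemma IsRegularityBound.continuous_pencilInv (hν : IsRegularityBound M₀ M₁ ν) (h : ν < ρ) :
    Continuous fun t : ℝ => pencilInv M₀ M₁ (Complex.I * t + ρ) :=
  continuous_iff_continuousAt.2 fun t =>
    ContinuousAt.comp (f := fun t : ℝ => Complex.I * (t : ℂ) + ρ)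
      (hν.differentiableAt_pencilInv (by simpa using h)).continuousAt (by fun_prop)

/-- The right-hand side of the Laplace representation lies in `L_2`, with a norm that stays bounded
as `ρ` grows. -/
lemma IsRegularityBound.exists_eLpNorm_le (hν : IsRegularityBound M₀ M₁ ν) (u₀ : H) {ρ₀ : ℝ}
    (h : ν < ρ₀) (h0 : 0 < ρ₀) : ∃ B : ℝ≥0∞, B ≠ ⊤ ∧ ∀ ρ : ℝ, ρ₀ ≤ ρ →
      MemLp (fun t : ℝ => ((√(2 * Real.pi))⁻¹ : ℂ) •
        pencilInv M₀ M₁ (Complex.I * t + ρ) (M₀ u₀)) 2 volume ∧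
      eLpNorm (fun t : ℝ => ((√(2 * Real.pi))⁻¹ : ℂ) •
        pencilInv M₀ M₁ (Complex.I * t + ρ) (M₀ u₀)) 2 volume ≤ B := by
  obtain ⟨C, hC0, hC⟩ := hν.exists_norm_pencilInv_le u₀
  have hne : ∀ ρ : ℝ, ρ₀ ≤ ρ → ∀ t : ℝ, Complex.I * t + ρ ≠ 0 := fun ρ hρ t h => by
    have := congrArg Complex.re h
    simp at this
    linarith
  have hg : MemLp (fun t : ℝ => ‖((√(2 * Real.pi))⁻¹ : ℂ)‖ * (C / ‖Complex.I * t + ρ₀‖)) 2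
      volume := by
    refine MemLp.const_mul ?_ _
    rw [memLp_two_iff_integrable_sq]
    · simpa only [div_pow] using integrable_const_div_sq h0 (C ^ 2)
    · refine (Continuous.div continuous_const (by fun_prop) fun t => ?_).aestronglyMeasurable
      exact norm_ne_zero_iff.2 (hne ρ₀ le_rfl t)
  refine ⟨_, hg.eLpNorm_ne_top, fun ρ hρ => ?_⟩
  have hle : ∀ᵐ t : ℝ ∂volume, ‖((√(2 * Real.pi))⁻¹ : ℂ) •
      pencilInv M₀ M₁ (Complex.I * t + ρ) (M₀ u₀)‖ ≤
      ‖((√(2 * Real.pi))⁻¹ : ℂ)‖ * (C / ‖Complex.I * t + ρ₀‖) := by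
    refine ae_of_all _ fun t => ?_
    rw [norm_smul]
    have h1 := hC (Complex.I * t + ρ) (by simpa using h.trans_le hρ)
      (by simpa using h0.trans_le hρ)
    have h2 : ‖Complex.I * t + ρ₀‖ ≤ ‖Complex.I * t + ρ‖ := by
      rw [← sq_le_sq₀ (norm_nonneg _) (norm_nonneg _), ← Complex.normSq_eq_norm_sq,
        ← Complex.normSq_eq_norm_sq, Complex.normSq_apply, Complex.normSq_apply]
      simp
      nlinarith
    have h3 := norm_pos_iff.2 (hne ρ₀ le_rfl t)
    exact mul_le_mul_of_nonneg_left (h1.trans (by gcongr)) (norm_nonneg _)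
  have hm : AEStronglyMeasurable (fun t : ℝ => ((√(2 * Real.pi))⁻¹ : ℂ) •
      pencilInv M₀ M₁ (Complex.I * t + ρ) (M₀ u₀)) volume :=
    (((hν.continuous_pencilInv (h.trans_le hρ)).clm_apply
      continuous_const).const_smul _).aestronglyMeasurable
  exact ⟨hg.mono' hm hle, eLpNorm_mono_ae_real hle⟩

lemma IsRegularityBound.exists_hasLaplaceRepresentation (hν : IsRegularityBound M₀ M₁ ν) (u₀ : H)
    (h : ν < ρ) (h0 : 0 < ρ) : ∃ u, HasLaplaceRepresentation M₀ M₁ u₀ u ρ := by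
  obtain ⟨B, -, hB⟩ := hν.exists_eLpNorm_le u₀ h h0
  obtain ⟨hm, -⟩ := hB ρ le_rfl
  refine ⟨(fourierLaplace H ρ).symm hm.toLp, Lp.memLp _, ?_⟩
  rw [Lp.toLp_coeFn, LinearIsometryEquiv.apply_symm_apply]
  exact hm.coeFn_toLp

/-- The inverse transform does not depend on `ρ`: tested against `C_c^∞`, it is a vertical
integral of a holomorphic function with quadratic decay. -/
lemma HasLaplaceRepresentation.ae_eq_of_le (hν : IsRegularityBound M₀ M₁ ν) {ρ₁ ρ₂ : ℝ}
    (h : ν < ρ₁) (h0 : 0 < ρ₁) (hle : ρ₁ ≤ ρ₂) (hu : HasLaplaceRepresentation M₀ M₁ u₀ u ρ₁)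
    (hv : HasLaplaceRepresentation M₀ M₁ u₀ v ρ₂) : u =ᵐ[volume] v := by
  obtain ⟨C, hC⟩ := hν.2
  refine ae_eq_of_integral_contDiff_smul_eq hu.locallyIntegrable hv.locallyIntegrable
    fun φ hφ hc => ?_
  rw [hu.integral_smul hφ hc, hv.integral_smul hφ hc]
  congr 1
  obtain ⟨K, hK0, hK⟩ := exists_norm_testTransform_le hφ hc ρ₂
  refine integral_vertical_eq (K := K * (|C| * ‖M₀ u₀‖))
    (f := fun z => testTransform φ z • pencilInv M₀ M₁ z (M₀ u₀)) h0 hle (fun z hz => ?_)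
    fun z hz hz' => ?_
  · exact (differentiable_testTransform hφ.continuous hc z).smul
      ((hν.differentiableAt_pencilInv (h.trans_le hz)).clm_apply (differentiableAt_const _))
  · have hz0 : z ≠ 0 := by rintro rfl; simp at hz; linarith
    rw [norm_smul, mul_div_right_comm]
    refine mul_le_mul (hK z (abs_le.2 ⟨by linarith, hz'⟩) hz0) ?_ (norm_nonneg _) (by positivity)
    exact (ContinuousLinearMap.le_opNorm _ _).trans (mul_le_mul_of_nonneg_right
      ((hC z (h.trans_le hz)).trans (le_abs_self C)) (norm_nonneg _))

lemma HasLaplaceRepresentation.of_bound (hν : IsRegularityBound M₀ M₁ ν) {ρ₁ ρ₂ : ℝ}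
    (h₁ : ν < ρ₁) (h₁0 : 0 < ρ₁) (h₂ : ν < ρ₂) (h₂0 : 0 < ρ₂)
    (hu : HasLaplaceRepresentation M₀ M₁ u₀ u ρ₁) : HasLaplaceRepresentation M₀ M₁ u₀ u ρ₂ := by
  obtain ⟨v, hv⟩ := hν.exists_hasLaplaceRepresentation u₀ h₂ h₂0
  rcases le_total ρ₁ ρ₂ with h | h
  · exact hv.congr (hu.ae_eq_of_le hν h₁ h₁0 h hv).symm
  · exact hv.congr (hv.ae_eq_of_le hν h₂ h₂0 h hu)

lemma HasLaplaceRepresentation.ae_eq_zero (hν : IsRegularityBound M₀ M₁ ν) (h : ν < ρ)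
    (h0 : 0 < ρ) (hu : HasLaplaceRepresentation M₀ M₁ u₀ u ρ) :
    ∀ᵐ t ∂(volume : Measure ℝ), t < 0 → u t = 0 := by
  obtain ⟨B, hB, hB'⟩ := hν.exists_eLpNorm_le u₀ h h0
  refine ae_eq_zero_of_eLpNorm_expMeasure_le (ρ₀ := ρ) hB hu.locallyIntegrable.aestronglyMeasurable
    fun ρ' hρ' => ?_
  obtain ⟨hm, hr⟩ := hu.of_bound hν h h0 (h.trans_le hρ') (h0.trans_le hρ')
  -- The Fourier–Laplace transform is isometric, so the norm of `u` in `L_{2,ρ'}` is that of its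
  -- transform.
  have h1 := (fourierLaplace H ρ').norm_map hm.toLp
  rw [Lp.norm_def, Lp.norm_def, ENNReal.toReal_eq_toReal_iff' (Lp.memLp _).eLpNorm_ne_top
    (Lp.memLp _).eLpNorm_ne_top, eLpNorm_congr_ae hr, eLpNorm_congr_ae hm.coeFn_toLp] at h1
  rw [← h1]
  exact (hB' ρ' hρ').2

/-- `(M₀ u)' + M₁ u = M₀ u₀ δ₀` on `ℝ` in the sense of distributions: on the transform side
this is `(z M₀ + M₁) ℳ(z)⁻¹ M₀ u₀ = M₀ u₀`. -/
lemma HasLaplaceRepresentation.integral_deriv_smul (hν : IsRegularityBound M₀ M₁ ν) (h : ν < ρ)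
    (h0 : 0 < ρ) (hu : HasLaplaceRepresentation M₀ M₁ u₀ u ρ) {ψ : ℝ → ℝ} (hψ : ContDiff ℝ ∞ ψ)
    (hc : HasCompactSupport ψ) :
    ∫ t, deriv ψ t • M₀ (u t) = (∫ t, ψ t • M₁ (u t)) - ψ 0 • M₀ u₀ := by
  obtain ⟨C, hC⟩ := hν.2
  have hui := hu.locallyIntegrable
  have hψ' : ContDiff ℝ ∞ (deriv ψ) := (contDiff_infty_iff_deriv.1 hψ).2
  have hint : ∀ φ : ℝ → ℝ, ContDiff ℝ ∞ φ → HasCompactSupport φ → Integrable fun t : ℝ =>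
      testTransform φ (Complex.I * t + ρ) • pencilInv M₀ M₁ (Complex.I * t + ρ) (M₀ u₀) := by
    intro φ hφ hc
    obtain ⟨K, hK0, hK⟩ := exists_norm_testTransform_le hφ hc ρ
    refine (integrable_const_div_sq h0 (K * (|C| * ‖M₀ u₀‖))).mono' ?_ (ae_of_all _ fun t => ?_)
    · exact (((differentiable_testTransform hφ.continuous hc).continuous.comp
        (by fun_prop : Continuous fun t : ℝ => Complex.I * (t : ℂ) + ρ)).smul
        ((hν.continuous_pencilInv h).clm_apply continuous_const)).aestronglyMeasurable
    · have hz0 : Complex.I * (t : ℂ) + ρ ≠ 0 := fun h => by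
        have := congrArg Complex.re h
        simp at this
        linarith
      rw [norm_smul, mul_div_right_comm]
      refine mul_le_mul (hK _ (by simp [abs_of_pos h0]) hz0) ?_ (norm_nonneg _) (by positivity)
      exact (ContinuousLinearMap.le_opNorm _ _).trans (mul_le_mul_of_nonneg_right
        ((hC _ (by simpa using h)).trans (le_abs_self C)) (norm_nonneg _))
  have hcomp : ∀ (L : H →L[ℂ] H) (φ : ℝ → ℝ), ContDiff ℝ ∞ φ → HasCompactSupport φ →
      ∫ t, φ t • L (u t) = ((2 * Real.pi : ℂ))⁻¹ • ∫ t : ℝ,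
        testTransform φ (Complex.I * t + ρ) •
          L (pencilInv M₀ M₁ (Complex.I * t + ρ) (M₀ u₀)) := by
    intro L φ hφ hc
    have h1 : ∀ t, φ t • L (u t) = L (φ t • u t) := fun t => by
      rw [← Complex.coe_smul, ← Complex.coe_smul, map_smul]
    simp only [h1]
    rw [L.integral_comp_comm (integrable_smul_of_hasCompactSupport hφ.continuous hc hui),
      hu.integral_smul hφ hc, map_smul, ← L.integral_comp_comm (hint φ hφ hc)]
    simp only [map_smul]
  have hi₀ := M₀.integrable_comp (hint _ hψ' hc.deriv)
  have hi₁ := M₁.integrable_comp (hint _ hψ hc)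
  simp only [map_smul] at hi₀ hi₁
  rw [hcomp M₀ _ hψ' hc.deriv, hcomp M₁ _ hψ hc, sub_eq_add_neg, ← sub_eq_iff_eq_add',
    ← smul_sub, ← integral_sub hi₀ hi₁]
  have h2 : ∀ t : ℝ, testTransform (deriv ψ) (Complex.I * t + ρ) •
      M₀ (pencilInv M₀ M₁ (Complex.I * t + ρ) (M₀ u₀)) - testTransform ψ (Complex.I * t + ρ) •
      M₁ (pencilInv M₀ M₁ (Complex.I * t + ρ) (M₀ u₀)) =
      (-testTransform ψ (Complex.I * t + ρ)) • M₀ u₀ := by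
    intro t
    have h3 := hν.pencil_pencilInv (z := Complex.I * t + ρ) (by simpa using h) (M₀ u₀)
    conv_rhs => rw [← h3]
    rw [pencil, add_apply, smul_apply, testTransform_deriv hψ hc]
    module
  simp only [h2]
  rw [integral_smul_const, integral_neg, integral_testTransform hψ hc, smul_smul]
  have hp : (2 * Real.pi : ℂ) ≠ 0 := by
    exact_mod_cast (by positivity : (2 * Real.pi : ℝ) ≠ 0)
  rw [mul_neg, inv_mul_cancel_left₀ hp, neg_smul, Complex.coe_smul]

lemma HasLaplaceRepresentation.solvesIntegrated (hν : IsRegularityBound M₀ M₁ ν) (h : ν < ρ)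
    (h0 : 0 < ρ) (hu : HasLaplaceRepresentation M₀ M₁ u₀ u ρ) :
    SolvesIntegrated M₀ M₁ u₀ u := by
  have hneg := hu.ae_eq_zero hν h h0
  have hui := hu.locallyIntegrable
  have hp₀ := locallyIntegrable_comp M₀ hui
  have hχ : LocallyIntegrable ((Set.Ioi (0 : ℝ)).indicator fun _ => M₀ u₀) :=
    (locallyIntegrable_const _).indicator measurableSet_Ioi
  obtain ⟨c, hc⟩ := exists_ae_add_primitive_eq_const (a := -1)
    (p := fun t => M₀ (u t) - (Set.Ioi (0 : ℝ)).indicator (fun _ => M₀ u₀) t) (hp₀.sub hχ)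
    (locallyIntegrable_comp M₁ hui) (fun ψ hψ hψc _ => by
      have hψ' : Continuous (deriv ψ) := hψ.continuous_deriv (by simp)
      simp only [smul_sub]
      rw [integral_sub (integrable_smul_of_hasCompactSupport hψ' hψc.deriv hp₀)
        (integrable_smul_of_hasCompactSupport hψ' hψc.deriv hχ),
        hu.integral_deriv_smul hν h h0 hψ hψc]
      have h1 : ∀ t, deriv ψ t • (Set.Ioi (0 : ℝ)).indicator (fun _ => M₀ u₀) t =
          (Set.Ioi (0 : ℝ)).indicator (fun t => deriv ψ t • M₀ u₀) t := fun t => by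
        simp [Set.indicator]
      simp only [h1]
      rw [integral_indicator measurableSet_Ioi, integral_smul_const,
        hψc.integral_Ioi_deriv_eq (hψ.of_le (by simp)), neg_smul, sub_neg_eq_add, sub_add_cancel])
  -- The constant vanishes because both terms do on `(-1, 0)`.
  have hc0 : c = 0 := by
    have h1 : ∀ᵐ t ∂(volume.restrict (Set.Ioo (-1 : ℝ) 0)), c = 0 := by
      rw [ae_restrict_iff' measurableSet_Ioo]
      filter_upwards [hc, hneg] with t ht ht' hmem
      rw [← ht hmem.1, ht' hmem.2, map_zero, Set.indicator_of_notMem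
        (by simpa using hmem.2.le), sub_zero, zero_add, intervalIntegral.integral_symm,
        neg_eq_zero]
      have hne : ∀ᵐ s ∂(volume : Measure ℝ), s ≠ 0 := by simp [ae_iff]
      refine intervalIntegral.integral_zero_ae ?_
      filter_upwards [hneg, hne] with s hs hs0 hmem'
      rw [Set.uIoc_of_le hmem.2.le] at hmem'
      rw [hs (lt_of_le_of_ne hmem'.2 hs0), map_zero]
    have : NeZero (volume.restrict (Set.Ioo (-1 : ℝ) 0)) := ⟨by simp⟩
    exact h1.exists.choose_spec
  filter_upwards [hc] with t ht h2
  have h3 := ht (by linarith)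
  rw [hc0, Set.indicator_of_mem (by simpa using h2), sub_add_eq_add_sub, sub_eq_zero] at h3
  exact h3

end Existence

/-! ### Primitives in the weighted Sobolev space -/

section Sobolev

lemma lintegral_ofReal_exp_Iic {a : ℝ} (ha : 0 < a) (t : ℝ) :
    ∫⁻ s in Set.Iic t, ENNReal.ofReal (Real.exp (a * s)) =
      ENNReal.ofReal (Real.exp (a * t)) * ENNReal.ofReal a⁻¹ := by
  rw [← ofReal_integral_eq_lintegral_ofReal (integrableOn_exp_mul_Iic ha t)
    (ae_of_all _ fun s => (Real.exp_pos _).le), integral_exp_mul_Iic ha, div_eq_mul_inv,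
    ENNReal.ofReal_mul (Real.exp_pos _).le]

lemma lintegral_ofReal_exp_Ici {a : ℝ} (ha : 0 < a) (t : ℝ) :
    ∫⁻ s in Set.Ici t, ENNReal.ofReal (Real.exp (-a * s)) =
      ENNReal.ofReal (Real.exp (-a * t)) * ENNReal.ofReal a⁻¹ := by
  have ha' : -a < 0 := by linarith
  rw [setLIntegral_congr Ioi_ae_eq_Ici.symm,
    ← ofReal_integral_eq_lintegral_ofReal (integrableOn_exp_mul_Ioi ha' t)
    (ae_of_all _ fun s => (Real.exp_pos _).le), integral_exp_mul_Ioi ha', neg_div_neg_eq,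
    div_eq_mul_inv, ENNReal.ofReal_mul (Real.exp_pos _).le]

lemma ofReal_exp_mul_ofReal_exp (x y : ℝ) :
    ENNReal.ofReal (Real.exp x) * ENNReal.ofReal (Real.exp y) =
      ENNReal.ofReal (Real.exp (x + y)) := by
  rw [← ENNReal.ofReal_mul (Real.exp_pos _).le, Real.exp_add]

/-- The Cauchy–Schwarz inequality for the splitting `f = (f e^{-ρ·/2}) e^{ρ·/2}`. -/
lemma lintegral_Iic_sq_le {ρ : ℝ} (hρ : 0 < ρ) {f : ℝ → ℝ≥0∞} (hf : AEMeasurable f volume)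
    (t : ℝ) : (∫⁻ s in Set.Iic t, f s) ^ 2 ≤
      (∫⁻ s in Set.Iic t, f s ^ 2 * ENNReal.ofReal (Real.exp (-ρ * s))) *
        (ENNReal.ofReal (Real.exp (ρ * t)) * ENNReal.ofReal ρ⁻¹) := by
  have h := ENNReal.lintegral_mul_le_Lp_mul_Lq (volume.restrict (Set.Iic t))
    Real.HolderConjugate.two_two
    (f := fun s => f s * ENNReal.ofReal (Real.exp (-ρ / 2 * s)))
    (g := fun s => ENNReal.ofReal (Real.exp (ρ / 2 * s)))
    (hf.restrict.mul (by fun_prop)) (by fun_prop)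
  have h1 : ∀ s, ((fun s => f s * ENNReal.ofReal (Real.exp (-ρ / 2 * s))) *
      fun s => ENNReal.ofReal (Real.exp (ρ / 2 * s))) s = f s := fun s => by
    rw [Pi.mul_apply, mul_assoc, ofReal_exp_mul_ofReal_exp]
    ring_nf
    simp
  have h2 : ∀ s, (f s * ENNReal.ofReal (Real.exp (-ρ / 2 * s))) ^ (2 : ℝ) =
      f s ^ 2 * ENNReal.ofReal (Real.exp (-ρ * s)) := fun s => by
    rw [ENNReal.rpow_two, mul_pow, pow_two (ENNReal.ofReal _), ofReal_exp_mul_ofReal_exp]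
    ring_nf
  have h3 : ∀ s, ENNReal.ofReal (Real.exp (ρ / 2 * s)) ^ (2 : ℝ) =
      ENNReal.ofReal (Real.exp (ρ * s)) := fun s => by
    rw [ENNReal.rpow_two, pow_two, ofReal_exp_mul_ofReal_exp]
    ring_nf
  simp only [h1, h2, h3] at h
  rw [← lintegral_ofReal_exp_Iic hρ]
  have h4 : ∀ x : ℝ≥0∞, (x ^ (1 / 2 : ℝ)) ^ 2 = x := fun x => by
    rw [← ENNReal.rpow_two, ← ENNReal.rpow_mul]
    norm_num
  calc _ ≤ _ := pow_le_pow_left' h 2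
    _ = _ := by rw [mul_pow, h4, h4]

/-- On `L_{2,ρ}` with `ρ > 0` integration from `-∞` is bounded, with norm at most `ρ⁻¹`. -/
lemma lintegral_primitive_sq_le {ρ : ℝ} (hρ : 0 < ρ) {f : ℝ → ℝ≥0∞} (hf : AEMeasurable f volume) :
    ∫⁻ t, (∫⁻ s in Set.Iic t, f s) ^ 2 ∂(expMeasure ρ) ≤
      ENNReal.ofReal ρ⁻¹ ^ 2 * ∫⁻ t, f t ^ 2 ∂(expMeasure ρ) := by
  have hdens : ∀ g : ℝ → ℝ≥0∞, ∫⁻ t, g t ∂(expMeasure ρ) =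
      ∫⁻ t, ENNReal.ofReal (Real.exp (-2 * ρ * t)) * g t := fun g => by
    rw [expMeasure, lintegral_withDensity_eq_lintegral_mul_non_measurable _ (by fun_prop)
      (ae_of_all _ fun t => by simp)]
    rfl
  rw [hdens, hdens]
  have hF : AEMeasurable (Function.uncurry fun t s : ℝ =>
      {p : ℝ × ℝ | p.2 ≤ p.1}.indicator (fun p => (f p.2 ^ 2 *
        ENNReal.ofReal (Real.exp (-ρ * p.2))) * ENNReal.ofReal (Real.exp (-ρ * p.1))) (t, s))
      ((volume : Measure ℝ).prod volume) := by
    refine AEMeasurable.indicator ?_ (measurableSet_le measurable_snd measurable_fst)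
    exact ((((hf.comp_snd).pow_const 2).mul (by fun_prop)).mul (by fun_prop))
  calc ∫⁻ t, ENNReal.ofReal (Real.exp (-2 * ρ * t)) * (∫⁻ s in Set.Iic t, f s) ^ 2
      ≤ ∫⁻ t, ENNReal.ofReal ρ⁻¹ * ∫⁻ s, {p : ℝ × ℝ | p.2 ≤ p.1}.indicator (fun p => (f p.2 ^ 2 *
        ENNReal.ofReal (Real.exp (-ρ * p.2))) * ENNReal.ofReal (Real.exp (-ρ * p.1))) (t, s) := by
        refine lintegral_mono fun t => ?_
        refine (mul_le_mul_right (lintegral_Iic_sq_le hρ hf t) _).trans_eq ?_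
        have h1 : ∀ s, {p : ℝ × ℝ | p.2 ≤ p.1}.indicator (fun p => (f p.2 ^ 2 *
            ENNReal.ofReal (Real.exp (-ρ * p.2))) * ENNReal.ofReal (Real.exp (-ρ * p.1))) (t, s)
            = (Set.Iic t).indicator (fun s => (f s ^ 2 *
            ENNReal.ofReal (Real.exp (-ρ * s))) * ENNReal.ofReal (Real.exp (-ρ * t))) s :=
          fun s => by simp [Set.indicator]
        simp only [h1]
        rw [lintegral_indicator measurableSet_Iic,
          lintegral_mul_const' _ _ ENNReal.ofReal_ne_top]
        have h2 : ENNReal.ofReal (Real.exp (-ρ * t)) = ENNReal.ofReal (Real.exp (-2 * ρ * t)) *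
            ENNReal.ofReal (Real.exp (ρ * t)) := by
          rw [ofReal_exp_mul_ofReal_exp]
          ring_nf
        rw [h2]
        ring
    _ = ENNReal.ofReal ρ⁻¹ * ∫⁻ s, ∫⁻ t, {p : ℝ × ℝ | p.2 ≤ p.1}.indicator (fun p => (f p.2 ^ 2 *
        ENNReal.ofReal (Real.exp (-ρ * p.2))) * ENNReal.ofReal (Real.exp (-ρ * p.1))) (t, s) := by
        rw [lintegral_const_mul' _ _ ENNReal.ofReal_ne_top, lintegral_lintegral_swap hF]
    _ = ENNReal.ofReal ρ⁻¹ * ∫⁻ s, ENNReal.ofReal ρ⁻¹ *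
        (ENNReal.ofReal (Real.exp (-2 * ρ * s)) * f s ^ 2) := by
        congr 2
        funext s
        have h1 : ∀ t, {p : ℝ × ℝ | p.2 ≤ p.1}.indicator (fun p => (f p.2 ^ 2 *
            ENNReal.ofReal (Real.exp (-ρ * p.2))) * ENNReal.ofReal (Real.exp (-ρ * p.1))) (t, s)
            = (Set.Ici s).indicator (fun t => (f s ^ 2 *
            ENNReal.ofReal (Real.exp (-ρ * s))) * ENNReal.ofReal (Real.exp (-ρ * t))) t :=
          fun t => by simp [Set.indicator]
        simp only [h1]
        rw [lintegral_indicator measurableSet_Ici, lintegral_const_mul _ (by fun_prop),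
          lintegral_ofReal_exp_Ici hρ]
        have h2 : ENNReal.ofReal (Real.exp (-2 * ρ * s)) = ENNReal.ofReal (Real.exp (-ρ * s)) *
            ENNReal.ofReal (Real.exp (-ρ * s)) := by
          rw [ofReal_exp_mul_ofReal_exp]
          ring_nf
        rw [h2]
        ring
    _ = _ := by
        rw [lintegral_const_mul' _ _ ENNReal.ofReal_ne_top]
        ring

variable {H : Type*} [NormedAddCommGroup H] [InnerProductSpace ℂ H]

lemma eLpNorm_primitive_le {ρ : ℝ} (hρ : 0 < ρ) {g : ℝ → H}
    (hg : AEStronglyMeasurable g volume) :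
    eLpNorm (fun t => ∫ s in Set.Iic t, g s) 2 (expMeasure ρ) ≤
      ENNReal.ofReal ρ⁻¹ * eLpNorm g 2 (expMeasure ρ) := by
  rw [eLpNorm_eq_lintegral_rpow_enorm_toReal (by simp) (by simp),
    eLpNorm_eq_lintegral_rpow_enorm_toReal (by simp) (by simp)]
  simp only [ENNReal.toReal_ofNat, ENNReal.rpow_two]
  have h : ∫⁻ t, ‖∫ s in Set.Iic t, g s‖ₑ ^ 2 ∂(expMeasure ρ) ≤
      ENNReal.ofReal ρ⁻¹ ^ 2 * ∫⁻ t, ‖g t‖ₑ ^ 2 ∂(expMeasure ρ) :=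
    (lintegral_mono fun t => pow_le_pow_left' (enorm_integral_le_lintegral_enorm _) 2).trans
      (lintegral_primitive_sq_le hρ hg.enorm)
  refine (ENNReal.rpow_le_rpow h (by norm_num)).trans_eq ?_
  rw [ENNReal.mul_rpow_of_nonneg _ _ (by norm_num), ← ENNReal.rpow_two, ← ENNReal.rpow_mul]
  norm_num

lemma eLpNorm_comp_sub_expMeasure (ρ a : ℝ) {g : ℝ → H} (hg : AEStronglyMeasurable g volume) :
    eLpNorm (fun t => g (t - a)) 2 (expMeasure ρ) =
      ENNReal.ofReal (Real.exp (-ρ * a)) * eLpNorm g 2 (expMeasure ρ) := by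
  rw [← eLpNorm_expMeasure, ← eLpNorm_expMeasure]
  have h1 : (fun t => (Real.exp (-ρ * t) : ℂ) • g (t - a)) =
      (Real.exp (-ρ * a) : ℂ) • ((fun t => (Real.exp (-ρ * t) : ℂ) • g t) ∘ fun t => t - a) := by
    funext t
    simp only [Pi.smul_apply, Function.comp_apply]
    rw [smul_smul, ← Complex.ofReal_mul, ← Real.exp_add]
    ring_nf
  have hm : AEStronglyMeasurable (fun t => (Real.exp (-ρ * t) : ℂ) • g t) volume :=
    AEStronglyMeasurable.smul (by fun_prop) hg
  rw [h1, eLpNorm_const_smul,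
    eLpNorm_comp_measurePreserving hm (measurePreserving_sub_right _ a),
    ← ofReal_norm, Complex.norm_real, Real.norm_of_nonneg (Real.exp_pos _).le]

instance (ρ : ℝ) : IsLocallyFiniteMeasure (expMeasure ρ) :=
  IsLocallyFiniteMeasure.withDensity_ofReal (by fun_prop)

variable [CompleteSpace H]

/-- Derivatives of test functions are dense in `L_{2,ρ}` for `ρ > 0`: a test function `ψ` is
corrected to mean zero by a bump of mass `∫ ψ`, which has small norm when it sits far to the
right. -/
lemma exists_deriv_eLpNorm_sub_le {ρ : ℝ} (hρ : 0 < ρ) {g : ℝ → H} (hg : MemLp g 2 (expMeasure ρ))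
    {ε : ℝ} (hε : 0 < ε) : ∃ φ : ℝ → H, ContDiff ℝ ∞ φ ∧ HasCompactSupport φ ∧
      (∀ t, φ t = ∫ s in Set.Iic t, deriv φ s) ∧
      eLpNorm (g - deriv φ) 2 (expMeasure ρ) ≤ ENNReal.ofReal ε := by
  obtain ⟨ψ, hψc, hψ, hψε⟩ := hg.exist_eLpNorm_sub_le (by simp) (by simp) (half_pos hε)
  let b : ContDiffBump (0 : ℝ) := ⟨1, 2, by norm_num, by norm_num⟩
  set η : ℝ → H := fun t => b.normed volume t • ∫ s, ψ s with hη
  have hηd : ContDiff ℝ ∞ η := b.contDiff_normed.smul contDiff_const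
  have hηc : HasCompactSupport η := b.hasCompactSupport_normed.smul_right
  have hηi : ∫ t, η t = ∫ t, ψ t := by
    rw [hη, integral_smul_const, b.integral_normed, one_smul]
  have hηm : MemLp η 2 (expMeasure ρ) := hηd.continuous.memLp_of_hasCompactSupport hηc
  obtain ⟨a, ha⟩ : ∃ a : ℝ, ENNReal.ofReal (Real.exp (-ρ * a)) * eLpNorm η 2 (expMeasure ρ) ≤
      ENNReal.ofReal (ε / 2) := by
    have h1 : Tendsto (fun a : ℝ => ENNReal.ofReal (Real.exp (-ρ * a)) *
        eLpNorm η 2 (expMeasure ρ)) atTop (𝓝 0) := by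
      have h2 : Tendsto (fun a : ℝ => Real.exp (-ρ * a)) atTop (𝓝 0) :=
        Real.tendsto_exp_atBot.comp (tendsto_id.const_mul_atTop_of_neg (by linarith))
      simpa using ENNReal.Tendsto.mul_const (ENNReal.tendsto_ofReal h2)
        (Or.inr hηm.eLpNorm_ne_top)
    exact (h1.eventually_le_const (by simpa using hε)).exists
  have hηa : ContDiff ℝ ∞ fun t => η (t - a) := hηd.comp (contDiff_id.sub contDiff_const)
  have hηac : HasCompactSupport fun t => η (t - a) :=
    hηc.comp_homeomorph (Homeomorph.subRight a)
  have hd : ContDiff ℝ ∞ fun t => ψ t - η (t - a) := hψ.sub hηa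
  have hdc : HasCompactSupport fun t => ψ t - η (t - a) := hψc.sub hηac
  obtain ⟨R, hR⟩ := hdc.isCompact.isBounded.subset_closedBall 0
  rw [Real.closedBall_eq_Icc] at hR
  obtain ⟨φ, hφ, hφc, -, hφd, hφi⟩ := exists_primitive_of_integral_eq_zero hd hR (by
    rw [integral_sub (hψ.continuous.integrable_of_hasCompactSupport hψc)
      (hηa.continuous.integrable_of_hasCompactSupport hηac), integral_sub_right_eq_self η a, hηi,
      sub_self])
  refine ⟨φ, hφ, hφc, fun t => by rw [hφd]; exact hφi t, ?_⟩
  have h1 : g - deriv φ = (g - ψ) + fun t => η (t - a) := by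
    rw [hφd]
    funext t
    simp only [Pi.sub_apply, Pi.add_apply]
    abel
  rw [h1]
  refine (eLpNorm_add_le (hg.1.sub hψ.continuous.aestronglyMeasurable)
    hηa.continuous.aestronglyMeasurable (by simp)).trans ?_
  rw [eLpNorm_comp_sub_expMeasure ρ a hηd.continuous.aestronglyMeasurable]
  refine (add_le_add hψε ha).trans_eq ?_
  rw [← ENNReal.ofReal_add (by positivity) (by positivity), add_halves]

lemma memH1_of_ae_eq_primitive {ρ : ℝ} (hρ : 0 < ρ) {f g : ℝ → H} (hg : MemLp g 2 (expMeasure ρ))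
    (hgi : ∀ t, IntegrableOn g (Set.Iic t)) (hfm : AEStronglyMeasurable f volume)
    (hf : f =ᵐ[volume] fun t => ∫ s in Set.Iic t, g s) : MemH1 ρ f := by
  have hgm : AEStronglyMeasurable g volume := hg.1.mono_ac (volume_ac_expMeasure ρ)
  have hfL : MemLp f 2 (expMeasure ρ) := by
    refine ⟨hfm.mono_ac (expMeasure_ac_volume ρ), ?_⟩
    rw [eLpNorm_congr_ae ((expMeasure_ac_volume ρ).ae_le hf)]
    exact (eLpNorm_primitive_le hρ hgm).trans_lt
      (ENNReal.mul_lt_top ENNReal.ofReal_lt_top hg.2)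
  refine ⟨hfL, hg.toLp, Metric.mem_closure_iff.2 fun ε hε => ?_⟩
  obtain ⟨δ, hδ, hδ1, hδ2⟩ : ∃ δ : ℝ, 0 < δ ∧ δ < ε ∧ ρ⁻¹ * δ < ε := by
    refine ⟨min (ε / 2) (ρ * (ε / 2)), by positivity, ?_, ?_⟩
    · exact (min_le_left _ _).trans_lt (by linarith)
    · have := mul_le_mul_of_nonneg_left (min_le_right (ε / 2) (ρ * (ε / 2))) (inv_pos.2 hρ).le
      rw [inv_mul_cancel_left₀ hρ.ne'] at this
      linarith
  obtain ⟨φ, hφ, hφc, hφi, hφε⟩ := exists_deriv_eLpNorm_sub_le hρ hg hδ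
  have hφ' : Continuous (deriv φ) := hφ.continuous_deriv (by simp)
  have hm : MemLp φ 2 (expMeasure ρ) := hφ.continuous.memLp_of_hasCompactSupport hφc
  have hm' : MemLp (deriv φ) 2 (expMeasure ρ) := hφ'.memLp_of_hasCompactSupport hφc.deriv
  refine ⟨(hm.toLp, hm'.toLp), ⟨φ, hφ, hφc, (volume_ac_expMeasure ρ).ae_le hm.coeFn_toLp,
    (volume_ac_expMeasure ρ).ae_le hm'.coeFn_toLp⟩, ?_⟩
  rw [Prod.dist_eq, max_lt_iff, ← edist_lt_ofReal, ← edist_lt_ofReal, Lp.edist_toLp_toLp,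
    Lp.edist_toLp_toLp]
  refine ⟨?_, hφε.trans_lt ((ENNReal.ofReal_lt_ofReal_iff hε).2 hδ1)⟩
  have h1 : f - φ =ᵐ[expMeasure ρ] fun t => ∫ s in Set.Iic t, (g - deriv φ) s := by
    filter_upwards [(expMeasure_ac_volume ρ).ae_le hf] with t ht
    simp only [Pi.sub_apply]
    rw [integral_sub (hgi t)
      (hφ'.integrable_of_hasCompactSupport hφc.deriv).integrableOn, ← hφi, ht]
  rw [eLpNorm_congr_ae h1]
  refine (eLpNorm_primitive_le hρ (hgm.sub hφ'.aestronglyMeasurable)).trans_lt ?_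
  refine (mul_le_mul_right hφε _).trans_lt ?_
  rw [← ENNReal.ofReal_mul (by positivity)]
  exact (ENNReal.ofReal_lt_ofReal_iff hε).2 hδ2

/-- The difference `M₀ (u - χ u₀)` is the primitive of `-M₁ u`. -/
lemma memH1_of_solvesIntegrated {M₀ M₁ : H →L[ℂ] H} {u₀ : H} {u : ℝ → H} {ρ : ℝ} (hρ : 0 < ρ)
    (hu : LocallyIntegrable u) (hneg : ∀ᵐ t ∂(volume : Measure ℝ), t < 0 → u t = 0)
    (h : SolvesIntegrated M₀ M₁ u₀ u) (hm : MemLp u 2 (expMeasure ρ)) :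
    MemH1 ρ fun t => M₀ (u t - (Set.Ici (0 : ℝ)).indicator (fun _ => u₀) t) := by
  have hM₁ := locallyIntegrable_comp M₁ hu
  have hne : ∀ᵐ s ∂(volume : Measure ℝ), s ≠ 0 := by simp [ae_iff]
  have hz : ∀ᵐ s ∂(volume : Measure ℝ), s ≤ 0 → -M₁ (u s) = 0 := by
    filter_upwards [hneg, hne] with s hs hs0 hle
    rw [hs (lt_of_le_of_ne hle hs0), map_zero, neg_zero]
  refine memH1_of_ae_eq_primitive (g := fun t => -M₁ (u t)) hρ (M₁.comp_memLp' hm).neg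
    (fun t => ?_) ?_ ?_
  · have h1 : IntegrableOn (fun t => -M₁ (u t)) (Set.Iic 0) :=
      integrableOn_zero.congr_fun_ae (by
        rw [EventuallyEq, ae_restrict_iff' measurableSet_Iic]
        filter_upwards [hz] with s hs hle using (hs hle).symm)
    refine (h1.union ((hM₁.integrableOn_isCompact (isCompact_Icc (a := 0) (b := t))).neg)).mono_set
      fun s hs => ?_
    rcases le_total s 0 with h | h
    · exact Or.inl h
    · exact Or.inr ⟨h, hs⟩
  · exact (locallyIntegrable_comp M₀ (hu.sub
      ((locallyIntegrable_const u₀).indicator measurableSet_Ici))).aestronglyMeasurable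
  · filter_upwards [h, hneg, hne] with t ht htn ht0
    rcases lt_or_gt_of_ne ht0 with hlt | hgt
    · rw [htn hlt, Set.indicator_of_notMem (by simpa using hlt), sub_zero, map_zero, eq_comm]
      refine setIntegral_eq_zero_of_ae_eq_zero ?_
      filter_upwards [hz] with s hs hmem using hs (le_trans hmem hlt.le)
    · rw [Set.indicator_of_mem (by simpa using hgt.le), map_sub, ← ht hgt, sub_add_cancel_left,
        setIntegral_eq_of_subset_of_ae_sdiff_eq_zero (s := Set.Ioc 0 t)
          measurableSet_Iic.nullMeasurableSet Set.Ioc_subset_Iic_self,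
        ← intervalIntegral.integral_of_le hgt.le, intervalIntegral.integral_neg]
      filter_upwards [hz] with s hs hmem
      exact hs (not_lt.1 fun h => hmem.2 ⟨h, hmem.1⟩)

end Sobolev

end DAE

theorem mainTheorem3 {H : Type*} [NormedAddCommGroup H] [InnerProductSpace ℂ H] [CompleteSpace H]
    (M₀ M₁ : H →L[ℂ] H) (hM : DAE.IsRegularPencil M₀ M₁) (u₀ : H) :
    (∀ u : ℝ → H, LocallyIntegrable u volume →
      List.TFAE [
        DAE.essSupport u ⊆ Set.Ici 0 ∧ DAE.SolvesDistributionally M₀ M₁ u ∧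
          DAE.AttainsInitialValue M₀ u₀ u,
        DAE.essSupport u ⊆ Set.Ici 0 ∧ DAE.SolvesIntegrated M₀ M₁ u₀ u,
        DAE.IsMildSolution M₀ M₁ u₀ u,
        ∀ ρ : ℝ, max (DAE.s₀ M₀ M₁) 0 < (ρ : EReal) →
          DAE.HasLaplaceRepresentation M₀ M₁ u₀ u ρ,
        ∃ ρ : ℝ, max (DAE.s₀ M₀ M₁) 0 < (ρ : EReal) ∧
          DAE.HasLaplaceRepresentation M₀ M₁ u₀ u ρ] ∧
      (DAE.IsMildSolution M₀ M₁ u₀ u →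
        ∀ ρ : ℝ, max (DAE.s₀ M₀ M₁) 0 < (ρ : EReal) →
          DAE.MemH1 ρ fun t => M₀ (u t - (Set.Ici (0 : ℝ)).indicator (fun _ => u₀) t))) ∧
    ∃ u : ℝ → H, DAE.IsMildSolution M₀ M₁ u₀ u ∧
      ∀ v : ℝ → H, DAE.IsMildSolution M₀ M₁ u₀ v → v =ᵐ[volume] u := by
  obtain ⟨ν, hν⟩ := hM
  -- A function with the Laplace representation solves the equation; conversely a solution agrees,
  -- by uniqueness, with the function that has the representation.
  have hmild : ∀ (u : ℝ → H) (ρ : ℝ), max (DAE.s₀ M₀ M₁) 0 < (ρ : EReal) →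
      DAE.HasLaplaceRepresentation M₀ M₁ u₀ u ρ →
        DAE.essSupport u ⊆ Set.Ici 0 ∧ DAE.SolvesIntegrated M₀ M₁ u₀ u := by
    intro u ρ hρ hu
    obtain ⟨h0, ν', hlt, hν'⟩ := DAE.exists_isRegularityBound_lt hρ
    exact ⟨DAE.essSupport_subset_Ici_iff.2 (hu.ae_eq_zero hν' hlt h0),
      hu.solvesIntegrated hν' hlt h0⟩
  have hlap : ∀ u : ℝ → H, LocallyIntegrable u → DAE.essSupport u ⊆ Set.Ici 0 →
      DAE.SolvesIntegrated M₀ M₁ u₀ u → ∀ ρ : ℝ, max (DAE.s₀ M₀ M₁) 0 < (ρ : EReal) →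
        DAE.HasLaplaceRepresentation M₀ M₁ u₀ u ρ := by
    intro u hu hu0 h ρ hρ
    obtain ⟨h0, ν', hlt, hν'⟩ := DAE.exists_isRegularityBound_lt hρ
    obtain ⟨v, hv⟩ := hν'.exists_hasLaplaceRepresentation u₀ hlt h0
    obtain ⟨hv0, hv1⟩ := hmild v ρ hρ hv
    exact hv.congr (DAE.ae_eq_of_solvesIntegrated ⟨ν, hν⟩ hu hv.locallyIntegrable hu0 hv0 h hv1)
  have hρ₀ : max (DAE.s₀ M₀ M₁) 0 < ((|ν| + 1 : ℝ) : EReal) :=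
    hν.max_s₀_lt (by linarith [le_abs_self ν]) (by positivity)
  refine ⟨fun u hu => ⟨?_, fun h ρ hρ => ?_⟩, ?_⟩
  · tfae_have 1 ↔ 2 := and_congr_right fun _ => (DAE.solvesIntegrated_iff hu).symm
    tfae_have 2 → 3 := fun h => ⟨hu, h.1, h.2, h.2.tendsto hu⟩
    tfae_have 3 → 4 := fun h => hlap u hu h.2.1 h.2.2.1
    tfae_have 4 → 5 := fun h => ⟨_, hρ₀, h _ hρ₀⟩
    tfae_have 5 → 2 := fun ⟨ρ, hρ, h⟩ => hmild u ρ hρ h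
    tfae_finish
  · exact DAE.memH1_of_solvesIntegrated (DAE.exists_isRegularityBound_lt hρ).1 hu
      (DAE.essSupport_subset_Ici_iff.1 h.2.1) h.2.2.1 (hlap u hu h.2.1 h.2.2.1 ρ hρ).choose
  · obtain ⟨h0, ν', hlt, hν'⟩ := DAE.exists_isRegularityBound_lt hρ₀
    obtain ⟨u, hu⟩ := hν'.exists_hasLaplaceRepresentation u₀ hlt h0
    obtain ⟨hu0, hu1⟩ := hmild u _ hρ₀ hu
    exact ⟨u, ⟨hu.locallyIntegrable, hu0, hu1, hu1.tendsto hu.locallyIntegrable⟩, fun v hv =>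
      DAE.ae_eq_of_solvesIntegrated ⟨ν, hν⟩ hu.locallyIntegrable hv.1 hu0 hv.2.1 hu1 hv.2.2.1⟩
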